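/- Let $K$ be a number field with ring of integers $\mathcal O_K$, and let $\mathcal A$ be a finite set of (distinct) affine hyperplanes in $K^d$, each given as the zero set $H=V(L_H)$ of a fixed affine linear polynomial $L_H\in\mathcal O_K[X_1,\dots,X_d]$. Let $\mathcal L(\mathcal A)$ be the set of all nonempty intersections of members of $\mathcal A$ (including $\hat 0=K^d$), ordered by reverse inclusion, with Möbius function $\mu$, and let $\widetilde{\mathcal L}(\mathcal A)=\mathcal L(\mathcal A)\setminus\{\hat 0\}$. For $x\in\mathcal L(\mathcal A)$ let $\mathrm{rk}(x)$ be the largest length of a chain from $\hat 0$ to $x$, let $\operatorname{codim}(x)$ be the codimension of $x$ in $K^d$, and put $\mathcal A_x=\{H\in\mathcal A: x\subseteq H\}$ and $\mathcal A^x=\{x\cap H : H\in\mathcal A\setminus\mathcal A_x,\ x\cap H\ne\emptyset\}$ (an arrangement in the affine space $x$); for $x\le y$ put $\mathcal A^x_y=(\mathcal A^x)_y$, and $\mathcal A^x_{\emptyset}=\mathcal A^x$. For an arrangement $\mathcal B$ let $\pi_{\mathcal B}(Y)=\sum_{x\in\mathcal L(\mathcal B)}\mu(\hat 0,x)(-Y)^{\mathrm{rk}(x)}$.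 For a (possibly empty) flag $F=(x_1<\dots<x_\ell)$ in $\widetilde{\mathcal L}(\mathcal A)$ let $\pi_F(Y)=\prod_{k=0}^{\ell}\pi_{\mathcal A^{x_k}_{x_{k+1}}}(Y)$, where $x_0=\hat 0$ and $x_{\ell+1}=\emptyset$. The flag Hilbert–Poincaré series of $\mathcal A$ is $$\mathsf{fHP}_{\mathcal A}\bigl(Y,(T_x)_{x\in\widetilde{\mathcal L}(\mathcal A)}\bigr)=\sum_{F}\pi_F(Y)\prod_{x\in F}\frac{T_x}{1-T_x},$$ the sum being over all flags $F$ in $\widetilde{\mathcal L}(\mathcal A)$. Let $\mathfrak o$ be a compact discrete valuation ring (of any characteristic) that is an $\mathcal O_K$-algebra, with maximal ideal $\mathfrak p$ and residue field of cardinality $q$, and assume that $\mathcal A$ has good reduction: $\mathcal L(\mathcal A)\cong\mathcal L(\mathcal A(\mathfrak o/\mathfrak p))$ as posets, where $\mathcal A(\mathfrak o/\mathfrak p)$ is the arrangement of the hyperplanes in $(\mathfrak o/\mathfrak p)^d$ defined by the reductions of the $L_H$. Let $|\cdot|$ be the absolute value on $\mathfrak o$ with $|\pi|=q^{-1}$ for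 a uniformizer $\pi$, put $\|\mathcal A_x\|=\max\{|L_H| : H\in\mathcal A_x\}$, and for $s=(s_x)\in\mathbb C^{\widetilde{\mathcal L}(\mathcal A)}$ let $$\zeta_{\mathcal A(\mathfrak o)}(s)=\int_{\mathfrak o^d}\prod_{x\in\widetilde{\mathcal L}(\mathcal A)}\|\mathcal A_x\|^{s_x}\,|dX|,$$ where $|dX|$ is the additive Haar measure on $\mathfrak o^d$ of total mass $1$. For $x\in\widetilde{\mathcal L}(\mathcal A)$ put $$g_x(s)=\operatorname{codim}(x)+\sum_{y\in\widetilde{\mathcal L}(\mathcal A_x)}s_y,\qquad h_x(r)=\sum_{y\in\widetilde{\mathcal L}(\mathcal A_x)}(r_y-\operatorname{codim}(y))\,\mu(y,x).$$ (1) If $\operatorname{Re} g_x(s)>0$ for all $x\in\widetilde{\mathcal L}(\mathcal A)$, then the integral $\zeta_{\mathcal A(\mathfrak o)}(s)$ converges absolutely and $$\zeta_{\mathcal A(\mathfrak o)}(s)=\mathsf{fHP}_{\mathcal A}\bigl(-q^{-1},(q^{-g_x(s)})_x\bigr).$$ (2) If $\operatorname{Re} r_x>0$ for all $x\in\widetilde{\mathcal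 L}(\mathcal A)$, then the integral $\zeta_{\mathcal A(\mathfrak o)}((h_x(r))_x)$ converges absolutely and $$\mathsf{fHP}_{\mathcal A}\bigl(-q^{-1},(q^{-r_x})_x\bigr)=\zeta_{\mathcal A(\mathfrak o)}\bigl((h_x(r))_x\bigr).$$ (3) The function $\zeta_{\mathcal A(\mathfrak o)}$ on the nonempty open set of all $s$ in (1) has an analytic continuation to the connected open set of all $s$ with $q^{-g_x(s)}\neq 1$ for all $x$. The continued function satisfies the identity in (1) for all these $s$, and the identity in (2) for all $r$ with $q^{-r_x}\ne1$ for all $x$. (4) Explicitly, for all $s$ as in (1), $$\zeta_{\mathcal A(\mathfrak o)}(s)=\sum_{F}\pi_F(-q^{-1})\prod_{x\in F}\frac{q^{-g_x(s)}}{1-q^{-g_x(s)}},$$ the sum being over all flags $F$ in $\widetilde{\mathcal L}(\mathcal A)$. If $\mathcal A$ is nonempty and central (all its members have a common point), with $\mathrm{rk}(\mathcal A)$ the largest rank of an element of $\mathcal L(\mathcal A)$ and $\hat 1$ the top element of $\mathcal L(\mathcal A)$, then also $$\zeta_{\mathcal A(\mathfrak o)}(s)=\frac{1}{1-q^{-\mathrm{rk}(\mathcal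 A)-\sum_{y\in\widetilde{\mathcal L}(\mathcal A)}s_y}}\sum_{F\not\ni\hat 1}\pi_F(-q^{-1})\prod_{x\in F}\frac{q^{-g_x(s)}}{1-q^{-g_x(s)}},$$ the sum being over all flags $F$ in $\widetilde{\mathcal L}(\mathcal A)\setminus\{\hat 1\}$. -/

import Mathlib

open MeasureTheory IsLocalRing

noncomputable section

/-! ### Hyperplane arrangements and their intersection posets -/

/-- A hyperplane arrangement in a nonempty affine subspace `ambient` of the affine space `V`:
a finite set of affine subspaces of `ambient`, nonempty and of codimension one in `ambient`.
(The ambient space is recorded because restrictions `A^x` are arrangements in the flat `x`.) -/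
structure Arrangement (k V : Type*) [Field k] [AddCommGroup V] [Module k V] where
  ambient : AffineSubspace k V
  ambient_nonempty : (ambient : Set V).Nonempty
  members : Finset (AffineSubspace k V)
  le_ambient : ∀ H ∈ members, H ≤ ambient
  nonempty : ∀ H ∈ members, (H : Set V).Nonempty
  finrank_add_one : ∀ H ∈ members,
    Module.finrank k H.direction + 1 = Module.finrank k ambient.direction

namespace Arrangement

section Basic

variable {k V : Type*} [Field k] [AddCommGroup V] [Module k V]

/-- The flats: nonempty intersections of members; the empty intersection is the ambient space. -/
def IsFlat (A : Arrangement k V) (x : AffineSubspace k V) : Prop :=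
  (x : Set V).Nonempty ∧ ∃ S ⊆ A.members, x = A.ambient ⊓ S.inf id

/-- The intersection poset `𝓛(A)`. -/
def IntPoset (A : Arrangement k V) : Type _ := {x : AffineSubspace k V // A.IsFlat x}

/-- `𝓛(A)` is ordered by reverse inclusion. -/
instance (A : Arrangement k V) : PartialOrder A.IntPoset :=
  PartialOrder.lift (fun x => OrderDual.toDual x.1) fun _ _ h => Subtype.ext h

theorem IntPoset.le_iff {A : Arrangement k V} (x y : A.IntPoset) : x ≤ y ↔ y.1 ≤ x.1 := Iff.rfl

instance (A : Arrangement k V) : Finite A.IntPoset := by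
  classical
  refine Set.Finite.to_subtype (s := {x | A.IsFlat x}) ?_
  refine ((A.members.powerset.image fun S => A.ambient ⊓ S.inf id).finite_toSet).subset ?_
  rintro x ⟨-, S, hS, rfl⟩
  exact Finset.mem_coe.2 (Finset.mem_image_of_mem _ (Finset.mem_powerset.2 hS))

instance (A : Arrangement k V) : Fintype A.IntPoset := Fintype.ofFinite _

instance (A : Arrangement k V) : DecidableEq A.IntPoset := Classical.decEq _

instance (A : Arrangement k V) : LocallyFiniteOrder A.IntPoset := by
  classical exact Fintype.toLocallyFiniteOrder

/-- The bottom element `0̂`, which is the ambient space. -/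
instance (A : Arrangement k V) : OrderBot A.IntPoset where
  bot := ⟨A.ambient, A.ambient_nonempty, ∅, by simp, by simp⟩
  bot_le := by
    rintro ⟨x, hx, S, hS, rfl⟩
    exact (inf_le_left : A.ambient ⊓ S.inf id ≤ A.ambient)

/-- `𝓛(A) ∖ {0̂}`. -/
abbrev Nonbot (A : Arrangement k V) : Type _ := {x : A.IntPoset // x ≠ ⊥}

instance (A : Arrangement k V) : Fintype A.Nonbot := Fintype.ofFinite _

/-- The rank of a flat: the supremum of the lengths of all chains ending in it. -/
def rk (A : Arrangement k V) (x : A.IntPoset) : ℕ := (Order.height x).toNat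

/-- The rank of the arrangement: the largest rank of a flat. -/
def rank (A : Arrangement k V) : ℕ := Finset.univ.sup A.rk

/-- The codimension of a flat in the ambient space. -/
def codim (A : Arrangement k V) (x : A.IntPoset) : ℕ :=
  Module.finrank k A.ambient.direction - Module.finrank k x.1.direction

/-- `A` is central if all its members have a common point. -/
def IsCentral (A : Arrangement k V) : Prop :=
  ((A.ambient ⊓ A.members.inf id : AffineSubspace k V) : Set V).Nonempty

/-- The Möbius function of `𝓛(A)`. -/
def mu (A : Arrangement k V) (x y : A.IntPoset) : ℤ := IncidenceAlgebra.mu ℤ x y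

/-- The Poincaré polynomial `∑ₓ μ(0̂, x) (-Y)^rk(x)`. -/
def poincare (A : Arrangement k V) : Polynomial ℤ :=
  ∑ x : A.IntPoset, Polynomial.C (A.mu ⊥ x) * (-Polynomial.X) ^ A.rk x

open Classical in
/-- The subarrangement `A_x` of all members that contain `x`. -/
def sub (A : Arrangement k V) (x : AffineSubspace k V) : Arrangement k V where
  ambient := A.ambient
  ambient_nonempty := A.ambient_nonempty
  members := A.members.filter fun H => x ≤ H
  le_ambient H hH := A.le_ambient H (Finset.mem_filter.1 hH).1
  nonempty H hH := A.nonempty H (Finset.mem_filter.1 hH).1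
  finrank_add_one H hH := A.finrank_add_one H (Finset.mem_filter.1 hH).1

theorem IntPoset.le_ambient {A : Arrangement k V} (x : A.IntPoset) : x.1 ≤ A.ambient :=
  (bot_le : (⊥ : A.IntPoset) ≤ x)

open Classical in
/-- The restriction `A^x`: the nonempty intersections of `x` with the members not containing `x`,
as an arrangement in `x`. -/
def restrict [FiniteDimensional k V] (A : Arrangement k V) (x : A.IntPoset) :
    Arrangement k V where
  ambient := x.1
  ambient_nonempty := x.2.1
  members := ((A.members.filter fun H => ¬ x.1 ≤ H).image fun H => x.1 ⊓ H).filter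
    fun Z => (Z : Set V).Nonempty
  le_ambient Z hZ := by
    obtain ⟨H, -, rfl⟩ := Finset.mem_image.1 (Finset.mem_filter.1 hZ).1
    exact inf_le_left
  nonempty Z hZ := (Finset.mem_filter.1 hZ).2
  finrank_add_one Z hZ := by
    obtain ⟨hZ, p, hp⟩ := Finset.mem_filter.1 hZ
    obtain ⟨H, hH, rfl⟩ := Finset.mem_image.1 hZ
    obtain ⟨hH, hxH⟩ := Finset.mem_filter.1 hH
    have hpx : p ∈ x.1 := hp.1
    have hpH : p ∈ H := hp.2
    rw [AffineSubspace.direction_inf_of_mem hpx hpH]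
    have hne : ¬ x.1.direction ≤ H.direction := fun h => hxH fun y hy => by
      have := AffineSubspace.vadd_mem_of_mem_direction
        (h (AffineSubspace.vsub_mem_direction hy hpx)) hpH
      simpa using this
    have h1 := Submodule.finrank_sup_add_finrank_inf_eq x.1.direction H.direction
    have h2 : Module.finrank k H.direction <
        Module.finrank k (x.1.direction ⊔ H.direction : Submodule k V) :=
      Submodule.finrank_lt_finrank_of_lt (lt_of_le_of_ne le_sup_right
        fun h => hne (le_sup_left.trans h.ge))
    have h3 : Module.finrank k (x.1.direction ⊔ H.direction : Submodule k V) ≤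
        Module.finrank k A.ambient.direction :=
      Submodule.finrank_mono (sup_le (AffineSubspace.direction_le x.le_ambient)
        (AffineSubspace.direction_le (A.le_ambient H hH)))
    have h4 := A.finrank_add_one H hH
    omega

end Basic

section Flags

variable {k V : Type*} [Field k] [AddCommGroup V] [Module k V]

/-- A (possibly empty) flag `x₁ < ⋯ < x_ℓ` in `𝓛(A) ∖ {0̂}`, that is, a simplex of its order
complex, as a strictly increasing list. -/
def Flag (A : Arrangement k V) : Type _ := {l : List A.Nonbot // l.Pairwise (· < ·)}

instance (A : Arrangement k V) : Finite A.Flag := by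
  classical
  exact Finite.of_injective
    (fun F : A.Flag => (⟨F.1, F.2.imp fun h => h.ne⟩ : {l : List A.Nonbot // l.Nodup}))
    fun F G h => Subtype.ext (Subtype.mk.inj h)

instance (A : Arrangement k V) : Fintype A.Flag := Fintype.ofFinite _

/-- `flagPoincareFrom A x₀ [x₁, …, x_ℓ]` is the product of the Poincaré polynomials of
`(A^{x_k})_{x_{k+1}}`, `0 ≤ k < ℓ`, and of `A^{x_ℓ}`. -/
def flagPoincareFrom [FiniteDimensional k V] (A : Arrangement k V) :
    A.IntPoset → List A.Nonbot → Polynomial ℤ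
  | x, [] => (A.restrict x).poincare
  | x, y :: l => ((A.restrict x).sub y.1.1).poincare * flagPoincareFrom A y.1 l

/-- The flag Poincaré polynomial `π_F`, with `x₀ = 0̂`. -/
def flagPoincare [FiniteDimensional k V] (A : Arrangement k V) (F : A.Flag) : Polynomial ℤ :=
  A.flagPoincareFrom ⊥ F.1

/-- The flag Hilbert–Poincaré series `∑_F π_F(Y) ∏_{x ∈ F} T_x / (1 - T_x)`, for `Y` and `T_x` in
any field `E`; for `E = ℚ(Y, T)` this is the rational function itself, for `E = ℂ` its values. -/
def fHP [FiniteDimensional k V] (A : Arrangement k V) {E : Type*} [Field E]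
    (Y : E) (T : A.Nonbot → E) : E :=
  ∑ F : A.Flag, Polynomial.aeval Y (A.flagPoincare F) *
    (F.1.map fun x => T x / (1 - T x)).prod

open Classical in
/-- `g_x(s) = codim(x) + ∑ s_y`, over `y ∈ 𝓛(A_x) ∖ {0̂}`. -/
def gFun (A : Arrangement k V) (s : A.Nonbot → ℂ) (x : A.Nonbot) : ℂ :=
  A.codim x.1 + ∑ y : A.Nonbot with (A.sub x.1.1).IsFlat y.1.1, s y

open Classical in
/-- `h_x(r) = ∑ (r_y - codim(y)) μ(y, x)`, over `y ∈ 𝓛(A_x) ∖ {0̂}`. -/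
def hFun (A : Arrangement k V) (r : A.Nonbot → ℂ) (x : A.Nonbot) : ℂ :=
  ∑ y : A.Nonbot with (A.sub x.1.1).IsFlat y.1.1, (r y - A.codim y.1) * (A.mu y.1 x.1 : ℂ)

/-- The tuples `s` such that `g_x(s)` has positive real part for all `x`. -/
def convDomain (A : Arrangement k V) : Set (A.Nonbot → ℂ) := {s | ∀ x, 0 < (A.gFun s x).re}

/-- The tuples `s` such that no denominator `1 - q^(-g_x(s))` vanishes. -/
def regularDomain (A : Arrangement k V) (q : ℂ) : Set (A.Nonbot → ℂ) :=
  {s | ∀ x, q ^ (-A.gFun s x) ≠ 1}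

end Flags

end Arrangement

/-! ### Affine linear polynomials and the arrangements they define -/

/-- The affine linear polynomial `const + ∑ⱼ coeff j * Xⱼ` over `R`. -/
structure AffineForm (R : Type*) (d : ℕ) where
  const : R
  coeff : Fin d → R

namespace AffineForm

/-- The value at a point with coordinates in an `R`-algebra. -/
def eval {R S : Type*} [CommRing R] [CommRing S] [Algebra R S] {d : ℕ} (f : AffineForm R d)
    (z : Fin d → S) : S :=
  algebraMap R S f.const + ∑ j, algebraMap R S (f.coeff j) * z j

variable {R : Type*} [CommRing R] {d : ℕ} (k : Type*) [Field k] [Algebra R k]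

/-- The linear part over `k`. -/
def linearPart (f : AffineForm R d) : (Fin d → k) →ₗ[k] k :=
  ∑ j, algebraMap R k (f.coeff j) • LinearMap.proj j

theorem linearPart_apply (f : AffineForm R d) (z : Fin d → k) :
    f.linearPart k z = ∑ j, algebraMap R k (f.coeff j) * z j := by
  simp [linearPart, LinearMap.sum_apply]
  simp only [Algebra.smul_def]

/-- The zero locus `V(f)` in `k^d`. -/
def zeroLocus (f : AffineForm R d) : AffineSubspace k (Fin d → k) where
  carrier := {z | f.eval z = 0}
  smul_vsub_vadd_mem' := by
    intro c p₁ p₂ p₃ h₁ h₂ h₃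
    simp only [Set.mem_ofPred_eq, eval, ← linearPart_apply] at *
    have e : f.linearPart k (c • (p₁ -ᵥ p₂) +ᵥ p₃) =
        c * (f.linearPart k p₁ - f.linearPart k p₂) + f.linearPart k p₃ := by
      simp [vsub_eq_sub, vadd_eq_add]
    rw [e]
    linear_combination c * h₁ - c * h₂ + h₃

/-- `f` has a nonzero linear part over `k`, so that `V(f)` is a hyperplane of `k^d`. -/
def IsNonconstant (f : AffineForm R d) : Prop := ∃ j, algebraMap R k (f.coeff j) ≠ 0

theorem mem_zeroLocus (f : AffineForm R d) (z : Fin d → k) :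
    z ∈ f.zeroLocus k ↔ f.eval z = 0 := Iff.rfl

theorem IsNonconstant.nonempty {f : AffineForm R d} (hf : f.IsNonconstant k) :
    (f.zeroLocus k : Set (Fin d → k)).Nonempty := by
  classical
  obtain ⟨j, hj⟩ := hf
  refine ⟨Pi.single j (-(algebraMap R k f.const) / algebraMap R k (f.coeff j)), ?_⟩
  change f.eval _ = 0
  simp [eval, Pi.single_apply]
  field_simp
  ring

theorem IsNonconstant.finrank {f : AffineForm R d} (hf : f.IsNonconstant k) :
    Module.finrank k (f.zeroLocus k).direction + 1 =
      Module.finrank k (⊤ : AffineSubspace k (Fin d → k)).direction := by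
  classical
  obtain ⟨p, hp⟩ := hf.nonempty
  have hdir : (f.zeroLocus k).direction = LinearMap.ker (f.linearPart k) := by
    ext v
    rw [← AffineSubspace.vadd_mem_iff_mem_direction v hp, mem_zeroLocus, LinearMap.mem_ker]
    have hp' : f.eval p = 0 := hp
    simp only [eval, ← linearPart_apply] at *
    rw [vadd_eq_add, map_add]
    exact ⟨fun h => by linear_combination h - hp', fun h => by linear_combination h + hp'⟩
  obtain ⟨j, hj⟩ := hf
  have hne : f.linearPart k ≠ 0 := by
    intro h
    have := congrArg (fun φ => φ (Pi.single j 1)) h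
    simp [linearPart_apply, Pi.single_apply] at this
    exact hj this
  rw [hdir, AffineSubspace.direction_top, finrank_top,
    Module.Dual.finrank_ker_add_one_of_ne_zero (f := f.linearPart k) hne]

open Classical in
/-- The arrangement in `k^d` of the hyperplanes `V(L i)`; a polynomial `L i` whose linear part
vanishes in `k` defines no hyperplane. -/
def arrangement {ι : Type*} [Fintype ι] (L : ι → AffineForm R d) :
    Arrangement k (Fin d → k) where
  ambient := ⊤
  ambient_nonempty := ⟨0, trivial⟩
  members := (Finset.univ.filter fun i => (L i).IsNonconstant k).image fun i => (L i).zeroLocus k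
  le_ambient _ _ := le_top
  nonempty H hH := by
    obtain ⟨i, hi, rfl⟩ := Finset.mem_image.1 hH
    exact (Finset.mem_filter.1 hi).2.nonempty
  finrank_add_one H hH := by
    obtain ⟨i, hi, rfl⟩ := Finset.mem_image.1 hH
    exact (Finset.mem_filter.1 hi).2.finrank

end AffineForm

/-! ### The analytic zeta function -/

section Zeta

/-- The cardinality `q` of the residue field. -/
def residueCard (𝔬 : Type*) [CommRing 𝔬] [IsLocalRing 𝔬] : ℕ := Nat.card (ResidueField 𝔬)

open Classical in
/-- The normalized absolute value on a discrete valuation ring: `|0| = 0` and `|a| = q^(-v(a))`. -/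
def dvrAbs {𝔬 : Type*} [CommRing 𝔬] [IsDomain 𝔬] [IsDiscreteValuationRing 𝔬] (a : 𝔬) : NNReal :=
  if a = 0 then 0
  else ((residueCard 𝔬 : NNReal)⁻¹) ^ (IsDiscreteValuationRing.addVal 𝔬 a).toNat

/-- The normalized Haar measure on `𝔬^d`: the product of the additive Haar measures of total
mass `1` on the factors. -/
def cubeHaar (𝔬 : Type*) [CommRing 𝔬] [TopologicalSpace 𝔬] [IsTopologicalRing 𝔬] [CompactSpace 𝔬]
    [MeasurableSpace 𝔬] [BorelSpace 𝔬] (d : ℕ) : Measure (Fin d → 𝔬) :=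
  Measure.pi fun _ => Measure.addHaarMeasure (⊤ : TopologicalSpace.PositiveCompacts 𝔬)

variable {R : Type*} [CommRing R] (K : Type*) [Field K] [Algebra R K] {d : ℕ}
  {ι : Type*} [Fintype ι] (L : ι → AffineForm R d)

open Classical in
/-- `‖A_x‖` at the point `z ∈ 𝔬^d`: the maximum of `|L(z)|` over the `L` vanishing on `x`. -/
def normSub {𝔬 : Type*} [CommRing 𝔬] [IsDomain 𝔬] [IsDiscreteValuationRing 𝔬] [Algebra R 𝔬]
    (x : AffineSubspace K (Fin d → K)) (z : Fin d → 𝔬) : NNReal :=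
  (Finset.univ.filter fun i => x ≤ (L i).zeroLocus K).sup fun i => dvrAbs ((L i).eval z)

/-- The integrand `∏ₓ ‖A_x‖^{s_x}` over `x ∈ 𝓛(A) ∖ {0̂}`. -/
def zetaIntegrand {𝔬 : Type*} [CommRing 𝔬] [IsDomain 𝔬] [IsDiscreteValuationRing 𝔬] [Algebra R 𝔬]
    (s : (AffineForm.arrangement K L).Nonbot → ℂ) (z : Fin d → 𝔬) : ℂ :=
  ∏ x, (((normSub K L x.1.1 z : NNReal) : ℝ) : ℂ) ^ s x

/-- The analytic zeta function `∫ ∏ₓ ‖A_x‖^{s_x} |dX|` over `𝔬^d`. -/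
def analyticZeta (𝔬 : Type*) [CommRing 𝔬] [IsDomain 𝔬] [IsDiscreteValuationRing 𝔬] [Algebra R 𝔬]
    [TopologicalSpace 𝔬] [IsTopologicalRing 𝔬] [CompactSpace 𝔬] [MeasurableSpace 𝔬] [BorelSpace 𝔬]
    (s : (AffineForm.arrangement K L).Nonbot → ℂ) : ℂ :=
  ∫ z, zetaIntegrand K L s z ∂(cubeHaar 𝔬 d)

/-- Good reduction: the intersection posets of the arrangement over `K` and of its reduction over
the residue field of `𝔬` are isomorphic. -/
def HasGoodReduction (𝔬 : Type*) [CommRing 𝔬] [IsLocalRing 𝔬] [Algebra R 𝔬] : Prop :=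
  Nonempty ((AffineForm.arrangement K L).IntPoset ≃o
    (AffineForm.arrangement (ResidueField 𝔬) L).IntPoset)

end Zeta

/-- `Z` is the analytic continuation to the connected open set `U` of the function `f`, given on
the nonempty open set `D ⊆ U`. -/
structure IsAnalyticContinuation {E : Type*} [NormedAddCommGroup E] [NormedSpace ℂ E]
    (f : E → ℂ) (D : Set E) (Z : E → ℂ) (U : Set E) : Prop where
  isOpen_left : IsOpen D
  nonempty : D.Nonempty
  isOpen : IsOpen U
  isConnected : IsConnected U
  subset : D ⊆ U
  analytic : AnalyticOnNhd ℂ Z U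
  eqOn : Set.EqOn Z f D

end

noncomputable section

namespace Arrangement

section Flats

variable {k V : Type*} [Field k] [AddCommGroup V] [Module k V]

theorem isFlat_sub_iff (A : Arrangement k V) {x : AffineSubspace k V} (hx : x ≤ A.ambient)
    (w : AffineSubspace k V) : (A.sub x).IsFlat w ↔ A.IsFlat w ∧ x ≤ w := by
  classical
  constructor
  · rintro ⟨hne, S, hS, rfl⟩
    refine ⟨⟨hne, S, fun H hH => (Finset.mem_filter.1 (hS hH)).1, rfl⟩, le_inf hx ?_⟩
    exact Finset.le_inf fun H hH => (Finset.mem_filter.1 (hS hH)).2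
  · rintro ⟨⟨hne, S, hS, rfl⟩, hw⟩
    refine ⟨hne, S, fun H hH => Finset.mem_filter.2 ⟨hS hH, hw.trans ?_⟩, rfl⟩
    exact inf_le_right.trans (Finset.inf_le hH)

theorem IsFlat.inf_member {A : Arrangement k V} {x H : AffineSubspace k V} (hx : A.IsFlat x)
    (hH : H ∈ A.members) (hne : ((x ⊓ H : AffineSubspace k V) : Set V).Nonempty) :
    A.IsFlat (x ⊓ H) := by
  classical
  obtain ⟨-, S, hS, rfl⟩ := hx
  refine ⟨hne, insert H S, Finset.insert_subset hH hS, ?_⟩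
  rw [Finset.inf_insert, id, inf_assoc, inf_comm H]

theorem isFlat_restrict_iff [FiniteDimensional k V] (A : Arrangement k V) (x : A.IntPoset)
    (w : AffineSubspace k V) : (A.restrict x).IsFlat w ↔ A.IsFlat w ∧ w ≤ x.1 := by
  classical
  constructor
  · rintro ⟨hne, S, hS, rfl⟩
    refine ⟨?_, inf_le_left⟩
    induction S using Finset.induction_on with
    | empty =>
      have : (A.restrict x).ambient ⊓ (∅ : Finset (AffineSubspace k V)).inf id = x.1 := by
        simp [restrict]
      rw [this]; exact x.2
    | insert Z S hZ ih =>
      rw [Finset.inf_insert, id, inf_comm Z, ← inf_assoc] at hne ⊢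
      have hZm := hS (Finset.mem_insert_self Z S)
      have hS' := (Finset.subset_insert Z S).trans hS
      have h0 := ih hS' (hne.mono inf_le_left)
      obtain ⟨H, hH, rfl⟩ := Finset.mem_image.1 (Finset.mem_filter.1 hZm).1
      have e : (A.restrict x).ambient ⊓ S.inf id ⊓ (x.1 ⊓ H) =
          (A.restrict x).ambient ⊓ S.inf id ⊓ H := by
        have h : (A.restrict x).ambient ⊓ S.inf id ≤ x.1 := inf_le_left
        rw [← inf_assoc, inf_eq_left.2 h]
      rw [e] at hne ⊢
      exact h0.inf_member (Finset.mem_filter.1 hH).1 hne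
  · rintro ⟨⟨hne, S, hS, hw⟩, hwx⟩
    refine ⟨hne, (S.filter fun H => ¬ x.1 ≤ H).image fun H => x.1 ⊓ H, ?_, ?_⟩
    · intro Z hZ
      obtain ⟨H, hH, rfl⟩ := Finset.mem_image.1 hZ
      obtain ⟨hHS, hxH⟩ := Finset.mem_filter.1 hH
      refine Finset.mem_filter.2 ⟨Finset.mem_image_of_mem _ (Finset.mem_filter.2 ⟨hS hHS, hxH⟩),
        hne.mono ?_⟩
      exact le_inf hwx (hw.le.trans (inf_le_right.trans (Finset.inf_le hHS)))
    · refine le_antisymm (le_inf hwx (Finset.le_inf ?_)) ?_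
      · intro Z hZ
        obtain ⟨H, hH, rfl⟩ := Finset.mem_image.1 hZ
        exact le_inf hwx (hw.le.trans (inf_le_right.trans (Finset.inf_le (Finset.mem_filter.1 hH).1)))
      · conv_rhs => rw [hw]
        refine le_inf (inf_le_left.trans x.le_ambient) (Finset.le_inf fun H hH => ?_)
        by_cases hxH : x.1 ≤ H
        · exact inf_le_left.trans hxH
        · exact inf_le_right.trans ((Finset.inf_le (Finset.mem_image_of_mem _
            (Finset.mem_filter.2 ⟨hH, hxH⟩))).trans inf_le_right)

theorem isFlat_restrict_sub_iff [FiniteDimensional k V] (A : Arrangement k V) {x y : A.IntPoset}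
    (hxy : x ≤ y) (w : AffineSubspace k V) :
    ((A.restrict x).sub y.1).IsFlat w ↔ A.IsFlat w ∧ w ≤ x.1 ∧ y.1 ≤ w := by
  rw [isFlat_sub_iff _ (show y.1 ≤ (A.restrict x).ambient from hxy), isFlat_restrict_iff, and_assoc]

end Flats

section Rank

variable {k V : Type*} [Field k] [AddCommGroup V] [Module k V] [FiniteDimensional k V]

theorem finrank_direction_lt {A : Arrangement k V} {x y : A.IntPoset} (h : x < y) :
    Module.finrank k y.1.direction < Module.finrank k x.1.direction := by
  refine Submodule.finrank_lt_finrank_of_lt ?_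
  refine AffineSubspace.direction_lt_of_nonempty ?_ y.2.1
  exact lt_of_le_of_ne h.le fun e => h.ne' (Subtype.ext e)

theorem finrank_add_codim (A : Arrangement k V) (x : A.IntPoset) :
    Module.finrank k x.1.direction + A.codim x = Module.finrank k A.ambient.direction :=
  Nat.add_sub_of_le (Submodule.finrank_mono (AffineSubspace.direction_le x.le_ambient))

omit [FiniteDimensional k V] in
@[simp] theorem codim_bot (A : Arrangement k V) : A.codim ⊥ = 0 := Nat.sub_self _

theorem codim_strictMono (A : Arrangement k V) : StrictMono A.codim := by
  intro x y h
  have := finrank_add_codim A x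
  have := finrank_add_codim A y
  have := finrank_direction_lt h
  omega

theorem finrank_inf_member (A : Arrangement k V) (x : A.IntPoset) {H : AffineSubspace k V}
    (hH : H ∈ A.members) (hx : ¬ x.1 ≤ H)
    (hne : ((x.1 ⊓ H : AffineSubspace k V) : Set V).Nonempty) :
    Module.finrank k (x.1 ⊓ H).direction + 1 = Module.finrank k x.1.direction := by
  classical
  refine (A.restrict x).finrank_add_one (x.1 ⊓ H) (Finset.mem_filter.2 ⟨?_, hne⟩)
  exact Finset.mem_image_of_mem _ (Finset.mem_filter.2 ⟨hH, hx⟩)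

theorem height_eq_codim (A : Arrangement k V) (x : A.IntPoset) :
    Order.height x = A.codim x := by
  classical
  refine le_antisymm ?_ ?_
  · simpa using Order.height_le_height_apply_of_strictMono _ A.codim_strictMono x
  · obtain ⟨x, hne, S, hS, rfl⟩ := x
    induction S using Finset.induction_on with
    | empty =>
      set z : A.IntPoset := ⟨A.ambient ⊓ (∅ : Finset (AffineSubspace k V)).inf id, hne, ∅, hS, rfl⟩
      have : z = ⊥ := le_bot_iff.1 (show A.ambient ≤ A.ambient ⊓ (∅ : Finset (AffineSubspace k V)).inf id by simp)
      rw [this]; simp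
    | insert H S hH ih =>
      have e : A.ambient ⊓ (insert H S).inf id = A.ambient ⊓ S.inf id ⊓ H := by
        rw [Finset.inf_insert, id, inf_comm H, inf_assoc]
      have hne' : ((A.ambient ⊓ S.inf id : AffineSubspace k V) : Set V).Nonempty := by
        rw [e] at hne
        exact hne.mono inf_le_left
      have hS' := (Finset.subset_insert H S).trans hS
      have h0 := ih hS' hne'
      set y : A.IntPoset := ⟨A.ambient ⊓ S.inf id, hne', S, hS', rfl⟩ with hy
      set z : A.IntPoset := ⟨A.ambient ⊓ (insert H S).inf id, hne, insert H S, hS, rfl⟩ with hz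
      have hz1 : z.1 = y.1 ⊓ H := e
      have hyz : y ≤ z := hz1.le.trans inf_le_left
      by_cases hyH : y.1 ≤ H
      · have : z = y := Subtype.ext (hz1.trans (inf_eq_left.2 hyH))
        rw [this]; exact h0
      · have hlt : y < z := lt_of_le_of_ne hyz fun h => hyH (by
          have : y.1 = y.1 ⊓ H := by rw [← hz1, ← h]
          exact inf_eq_left.1 this.symm)
        have h1 := A.finrank_inf_member y (hS (Finset.mem_insert_self H S)) hyH
          (by rw [← hz1]; exact hne)
        have h2 := finrank_add_codim A y
        have h3 := finrank_add_codim A z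
        rw [hz1] at h3
        have h4 : A.codim z = A.codim y + 1 := by omega
        rw [h4]
        refine le_trans ?_ (Order.height_add_one_le hlt)
        push_cast
        gcongr

theorem rk_eq_codim (A : Arrangement k V) (x : A.IntPoset) : A.rk x = A.codim x := by
  simp [rk, height_eq_codim]

open Classical in
/-- Möbius inversion: the Poincaré polynomial at `-t` is the value at `⊥` of any function whose
sums over the upper sets are the powers of `t`. -/
theorem aeval_poincare_of_sum (A : Arrangement k V) (t : ℂ) (N : A.IntPoset → ℂ)
    (hN : ∀ x, ∑ y : A.IntPoset with x ≤ y, N y = t ^ A.codim x) :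
    Polynomial.aeval (-t) A.poincare = N ⊥ := by
  classical
  have h1 : Polynomial.aeval (-t) A.poincare =
      ∑ x : A.IntPoset, (A.mu ⊥ x : ℂ) * t ^ A.codim x := by
    simp [poincare, rk_eq_codim]
  rw [h1]
  simp_rw [← hN, Finset.mul_sum, Finset.sum_filter]
  rw [Finset.sum_comm]
  have h2 : ∀ y : A.IntPoset, ∑ x : A.IntPoset, (if x ≤ y then (A.mu ⊥ x : ℂ) * N y else 0) =
      if ⊥ = y then N y else 0 := by
    intro y
    have := congrArg (fun n : ℤ => (n : ℂ) * N y)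
      (IncidenceAlgebra.sum_Icc_mu_right (𝕜 := ℤ) (⊥ : A.IntPoset) y)
    simp only [Int.cast_sum, Finset.sum_mul] at this
    rw [← Finset.sum_filter]
    have e : Finset.univ.filter (fun x : A.IntPoset => x ≤ y) = Finset.Icc ⊥ y := by
      ext; simp
    rw [e]
    refine Eq.trans (by rfl) (this.trans ?_)
    split_ifs <;> simp
  rw [Finset.sum_congr rfl fun y _ => h2 y]
  simp

end Rank

section Exponents

variable {k V : Type*} [Field k] [AddCommGroup V] [Module k V]

theorem isFlat_sub_intPoset_iff (A : Arrangement k V) (x y : A.IntPoset) :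
    (A.sub x.1).IsFlat y.1 ↔ y ≤ x := by
  rw [isFlat_sub_iff _ x.le_ambient]
  exact ⟨fun h => h.2, fun h => ⟨y.2, h⟩⟩

open Classical in
theorem gFun_eq (A : Arrangement k V) (s : A.Nonbot → ℂ) (x : A.Nonbot) :
    A.gFun s x = A.codim x.1 + ∑ y : A.Nonbot with y ≤ x, s y := by
  simp only [gFun, isFlat_sub_intPoset_iff]
  rfl

open Classical in
theorem hFun_eq (A : Arrangement k V) (r : A.Nonbot → ℂ) (x : A.Nonbot) :
    A.hFun r x = ∑ y : A.Nonbot with y ≤ x, (r y - A.codim y.1) * (A.mu y.1 x.1 : ℂ) := by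
  simp only [hFun, isFlat_sub_intPoset_iff]
  rfl

theorem gFun_hFun (A : Arrangement k V) (r : A.Nonbot → ℂ) : A.gFun (A.hFun r) = r := by
  classical
  funext x
  rw [gFun_eq]
  simp_rw [hFun_eq, Finset.sum_filter]
  have h2 : ∀ z : A.Nonbot, ∑ y : A.Nonbot, (if y ≤ x ∧ z ≤ y then (A.mu z.1 y.1 : ℂ) else 0) =
      if z = x then 1 else 0 := by
    intro z
    have h := congrArg (fun n : ℤ => (n : ℂ)) (IncidenceAlgebra.sum_Icc_mu_right (𝕜 := ℤ) z.1 x.1)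
    have e : Finset.Icc z.1 x.1 = (Finset.univ.filter fun y : A.Nonbot => y ≤ x ∧ z ≤ y).map
        (Function.Embedding.subtype _) := by
      ext y
      simp only [Finset.mem_Icc, Finset.mem_map, Finset.mem_filter, Finset.mem_univ, true_and,
        Function.Embedding.coe_subtype]
      constructor
      · rintro ⟨h1, h2⟩
        exact ⟨⟨y, fun hy => z.2 (le_bot_iff.1 (hy ▸ h1))⟩, ⟨h2, h1⟩, rfl⟩
      · rintro ⟨y, ⟨h1, h2⟩, rfl⟩
        exact ⟨h2, h1⟩
    rw [e, Finset.sum_map] at h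
    rw [← Finset.sum_filter]
    push_cast at h
    refine Eq.trans (by rfl) (h.trans ?_)
    simp only [Subtype.ext_iff]
  have h1 : ∑ y : A.Nonbot, (if y ≤ x then ∑ z : A.Nonbot,
      (if z ≤ y then (r z - A.codim z.1) * (A.mu z.1 y.1 : ℂ) else 0) else 0) =
      ∑ z : A.Nonbot, (r z - A.codim z.1) *
        ∑ y : A.Nonbot, (if y ≤ x ∧ z ≤ y then (A.mu z.1 y.1 : ℂ) else 0) := by
    simp_rw [Finset.mul_sum]
    rw [Finset.sum_comm]
    refine Finset.sum_congr rfl fun y _ => ?_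
    by_cases hy : y ≤ x
    · simp [hy, mul_ite]
    · simp [hy]
  rw [h1]
  simp_rw [h2]
  simp

theorem hFun_gFun (A : Arrangement k V) (s : A.Nonbot → ℂ) : A.hFun (A.gFun s) = s := by
  classical
  funext x
  rw [hFun_eq]
  simp_rw [gFun_eq, add_sub_cancel_left]
  have h2 : ∀ z : A.Nonbot, ∑ y : A.Nonbot, (if y ≤ x ∧ z ≤ y then (A.mu y.1 x.1 : ℂ) else 0) =
      if z = x then 1 else 0 := by
    intro z
    have h := congrArg (fun n : ℤ => (n : ℂ)) (IncidenceAlgebra.sum_Icc_mu_left (𝕜 := ℤ) z.1 x.1)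
    have e : Finset.Icc z.1 x.1 = (Finset.univ.filter fun y : A.Nonbot => y ≤ x ∧ z ≤ y).map
        (Function.Embedding.subtype _) := by
      ext y
      simp only [Finset.mem_Icc, Finset.mem_map, Finset.mem_filter, Finset.mem_univ, true_and,
        Function.Embedding.coe_subtype]
      constructor
      · rintro ⟨h1, h2⟩
        exact ⟨⟨y, fun hy => z.2 (le_bot_iff.1 (hy ▸ h1))⟩, ⟨h2, h1⟩, rfl⟩
      · rintro ⟨y, ⟨h1, h2⟩, rfl⟩
        exact ⟨h2, h1⟩
    rw [e, Finset.sum_map] at h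
    rw [← Finset.sum_filter]
    push_cast at h
    refine Eq.trans (by rfl) (h.trans ?_)
    simp only [Subtype.ext_iff]
  have h1 : ∑ y : A.Nonbot with y ≤ x, (∑ z : A.Nonbot with z ≤ y, s z) * (A.mu y.1 x.1 : ℂ) =
      ∑ z : A.Nonbot, s z *
        ∑ y : A.Nonbot, (if y ≤ x ∧ z ≤ y then (A.mu y.1 x.1 : ℂ) else 0) := by
    simp_rw [Finset.mul_sum]
    rw [Finset.sum_comm, Finset.sum_filter]
    refine Finset.sum_congr rfl fun y _ => ?_
    by_cases hy : y ≤ x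
    · simp [hy, Finset.sum_mul, Finset.sum_filter]
    · simp [hy]
  rw [h1]
  simp_rw [h2]
  simp

end Exponents

section FlagSums

variable {k V : Type*} [Field k] [AddCommGroup V] [Module k V] [FiniteDimensional k V]

open Classical in
/-- The part of the flag Hilbert–Poincaré series that comes from the flags above `x` all of whose
members satisfy `Q`. -/
def flagSum (A : Arrangement k V) (Y : ℂ) (τ : A.Nonbot → ℂ) (Q : A.Nonbot → Prop)
    (x : A.IntPoset) : ℂ :=
  ∑ F : A.Flag with ∀ y ∈ F.1, x < y.1 ∧ Q y,
    Polynomial.aeval Y (A.flagPoincareFrom x F.1) * (F.1.map τ).prod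

open Classical in
theorem flagSum_eq (A : Arrangement k V) (Y : ℂ) (τ : A.Nonbot → ℂ) (Q : A.Nonbot → Prop)
    (x : A.IntPoset) :
    A.flagSum Y τ Q x = Polynomial.aeval Y (A.restrict x).poincare +
      ∑ y : A.Nonbot with x < y.1 ∧ Q y,
        Polynomial.aeval Y ((A.restrict x).sub y.1.1).poincare * τ y * A.flagSum Y τ Q y.1 := by
  let P : A.IntPoset → A.Flag → Prop := fun x F => ∀ y ∈ F.1, x < y.1 ∧ Q y
  let f : A.IntPoset → A.Flag → ℂ := fun x F =>
    Polynomial.aeval Y (A.flagPoincareFrom x F.1) * (F.1.map τ).prod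
  have hsum : ∀ x, A.flagSum Y τ Q x = ∑ F : {F : A.Flag // P x F}, f x F.1 := by
    intro x
    rw [flagSum, ← Finset.sum_subtype_eq_sum_filter, Finset.subtype_univ]
  let e : Option (Σ y : {y : A.Nonbot // x < y.1 ∧ Q y}, {F : A.Flag // P y.1.1 F}) →
      {F : A.Flag // P x F} := fun o => match o with
    | none => ⟨⟨[], List.Pairwise.nil⟩, fun y hy => absurd hy List.not_mem_nil⟩
    | some ⟨y, F⟩ => ⟨⟨y.1 :: F.1.1, List.pairwise_cons.2 ⟨fun z hz => (F.2 z hz).1, F.1.2⟩⟩, by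
        intro z hz
        rcases List.mem_cons.1 hz with rfl | hz
        · exact y.2
        · exact ⟨y.2.1.trans (F.2 z hz).1, (F.2 z hz).2⟩⟩
  have he : Function.Bijective e := by
    constructor
    · rintro (_ | ⟨⟨y, hy⟩, ⟨⟨F, hF⟩, hF'⟩⟩) (_ | ⟨⟨z, hz⟩, ⟨⟨G, hG⟩, hG'⟩⟩) h
      · rfl
      · exact absurd (congrArg (fun F => F.1.1) h) (List.cons_ne_nil _ _).symm
      · exact absurd (congrArg (fun F => F.1.1) h) (List.cons_ne_nil _ _)
      · have := congrArg (fun F => F.1.1) h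
        simp only [e, List.cons.injEq] at this
        obtain ⟨rfl, rfl⟩ := this
        rfl
    · rintro ⟨⟨F, hF⟩, hF'⟩
      cases F with
      | nil => exact ⟨none, rfl⟩
      | cons y F =>
        have h1 := List.pairwise_cons.1 hF
        exact ⟨some ⟨⟨y, hF' y List.mem_cons_self⟩, ⟨⟨F, h1.2⟩, fun z hz =>
          ⟨h1.1 z hz, (hF' z (List.mem_cons_of_mem _ hz)).2⟩⟩⟩, rfl⟩
  rw [hsum, ← Fintype.sum_bijective e he (fun o => f x (e o).1) _ fun _ => rfl,
    Fintype.sum_option, Fintype.sum_sigma, ← Finset.sum_subtype_eq_sum_filter,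
    Finset.subtype_univ]
  congr 1
  · simp [f, e, flagPoincareFrom]
  · refine Finset.sum_congr rfl fun y _ => ?_
    rw [hsum, Finset.mul_sum]
    refine Finset.sum_congr rfl fun F _ => ?_
    simp [f, e, flagPoincareFrom]
    ring

open Classical in
/-- If `W` satisfies the recursion of the sums over the flags with a given largest member, then
the weighted sum of the values of `W` is the sum over all flags. -/
theorem sum_mul_poincare_eq_flagSum (A : Arrangement k V) (Y : ℂ) (τ : A.Nonbot → ℂ)
    (Q : A.Nonbot → Prop) (hQ : ∀ y z, y ≤ z → Q z → Q y) (W : A.IntPoset → ℂ) (h0 : W ⊥ = 1)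
    (hW : ∀ y : A.Nonbot, W y.1 = τ y * ∑ z : A.IntPoset with z < y.1,
      Polynomial.aeval Y ((A.restrict z).sub y.1.1).poincare * W z) :
    ∑ y : A.IntPoset with ∀ h : y ≠ ⊥, Q ⟨y, h⟩,
      Polynomial.aeval Y (A.restrict y).poincare * W y = A.flagSum Y τ Q ⊥ := by
  set G := A.flagSum Y τ Q
  set P : A.IntPoset → A.IntPoset → ℂ := fun x y =>
    Polynomial.aeval Y ((A.restrict x).sub y.1).poincare with hP
  have hG : ∀ x, Polynomial.aeval Y (A.restrict x).poincare =
      G x - ∑ z : A.Nonbot, if x < z.1 ∧ Q z then P x z.1 * τ z * G z.1 else 0 := by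
    intro x
    rw [← Finset.sum_filter]
    exact eq_sub_of_add_eq (flagSum_eq A Y τ Q x).symm
  have hW' : ∀ z : A.Nonbot, Q z → G z.1 * W z.1 =
      ∑ y : A.IntPoset, if (∀ h : y ≠ ⊥, Q ⟨y, h⟩) then
        (if y < z.1 ∧ Q z then P y z.1 * τ z * G z.1 else 0) * W y else 0 := by
    intro z hz
    rw [hW z, ← mul_assoc, Finset.mul_sum, Finset.sum_filter]
    refine Finset.sum_congr rfl fun y _ => ?_
    by_cases hyz : y < z.1
    · have : ∀ h : y ≠ ⊥, Q ⟨y, h⟩ := fun h => hQ _ z hyz.le hz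
      rw [if_pos this, if_pos hyz, if_pos ⟨hyz, hz⟩]
      simp only [hP]; ring
    · simp [hyz]
  have hsplit : ∑ y : A.IntPoset, (if (∀ h : y ≠ ⊥, Q ⟨y, h⟩) then G y * W y else 0) =
      G ⊥ + ∑ z : A.Nonbot, if Q z then G z.1 * W z.1 else 0 := by
    rw [← Finset.add_sum_erase _ _ (Finset.mem_univ ⊥)]
    congr 1
    · simp [h0]
    · refine (Finset.sum_subtype (F := inferInstanceAs (Fintype A.Nonbot)) (p := fun y => y ≠ ⊥) _
        (by simp) _).trans ?_
      refine Finset.sum_congr rfl fun z _ => ?_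
      have : (∀ h : z.1 ≠ ⊥, Q ⟨z.1, h⟩) ↔ Q z := ⟨fun h => h z.2, fun h _ => h⟩
      simp only [this]
  rw [Finset.sum_filter]
  simp_rw [hG, sub_mul]
  have : ∀ y : A.IntPoset, (if (∀ h : y ≠ ⊥, Q ⟨y, h⟩) then G y * W y -
      (∑ z : A.Nonbot, if y < z.1 ∧ Q z then P y z.1 * τ z * G z.1 else 0) * W y else 0) =
      (if (∀ h : y ≠ ⊥, Q ⟨y, h⟩) then G y * W y else 0) -
      ∑ z : A.Nonbot, if (∀ h : y ≠ ⊥, Q ⟨y, h⟩) then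
        (if y < z.1 ∧ Q z then P y z.1 * τ z * G z.1 else 0) * W y else 0 := by
    intro y
    split_ifs
    · rw [Finset.sum_mul]
    · simp
  rw [Finset.sum_congr rfl fun y _ => this y, Finset.sum_sub_distrib, hsplit, Finset.sum_comm]
  rw [add_sub_assoc, add_eq_left, sub_eq_zero]
  refine Finset.sum_congr rfl fun z _ => ?_
  by_cases hz : Q z
  · rw [if_pos hz, hW' z hz]
  · simp [hz]

theorem flagSum_bot (A : Arrangement k V) (Y : ℂ) (τ : A.Nonbot → ℂ) (Q : A.Nonbot → Prop)
    [DecidablePred fun F : A.Flag => ∀ x ∈ F.1, Q x] :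
    A.flagSum Y τ Q ⊥ = ∑ F : A.Flag with ∀ x ∈ F.1, Q x,
      Polynomial.aeval Y (A.flagPoincare F) * (F.1.map τ).prod := by
  classical
  refine Finset.sum_congr (Finset.ext fun F => ?_) fun F _ => rfl
  simp only [Finset.mem_filter, Finset.mem_univ, true_and]
  exact forall₂_congr fun y _ => and_iff_right (bot_lt_iff_ne_bot.2 y.2)

theorem fHP_eq_flagSum (A : Arrangement k V) (Y : ℂ) (T : A.Nonbot → ℂ) :
    A.fHP Y T = A.flagSum Y (fun x => T x / (1 - T x)) (fun _ => True) ⊥ := by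
  classical
  rw [flagSum_bot]
  refine Finset.sum_congr (Finset.ext fun F => ?_) fun F _ => rfl
  simp

end FlagSums

end Arrangement

theorem linearIndependent_iff_pi_surjective {F V B : Type*} [Field F] [AddCommGroup V] [Module F V]
    [Fintype B] (l : B → V →ₗ[F] F) :
    LinearIndependent F l ↔ Function.Surjective (LinearMap.pi l) := by
  classical
  constructor
  · intro h
    rw [← LinearMap.dualMap_injective_iff, ← LinearMap.ker_eq_bot, LinearMap.ker_eq_bot']
    intro φ hφ
    have h1 : ∑ i, φ (Pi.single i 1) • l i = 0 := by
      ext v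
      have := LinearMap.congr_fun hφ v
      rw [LinearMap.dualMap_apply, LinearMap.pi_apply_eq_sum_univ φ] at this
      rw [LinearMap.sum_apply]
      refine Eq.trans (Finset.sum_congr rfl fun i _ => ?_) this
      simp [mul_comm]
      left; congr 1; ext j; simp [Pi.single_apply, eq_comm]
    have h2 := Fintype.linearIndependent_iff.1 h _ h1
    refine LinearMap.pi_ext' fun i => LinearMap.ext_ring ?_
    simpa using h2 i
  · intro h
    rw [Fintype.linearIndependent_iff]
    intro g hg i
    obtain ⟨v, hv⟩ := h (Pi.single i 1)
    have := LinearMap.congr_fun hg v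
    rw [LinearMap.sum_apply] at this
    have h3 : ∀ j, l j v = (Pi.single i 1 : B → F) j := fun j => congrFun hv j
    simpa [h3, Pi.single_apply] using this

namespace AffineForm

section Linear

variable {R : Type*} [CommRing R] {d : ℕ} {ι : Type*} (F : Type*) [Field F] [Algebra R F]
  (L : ι → AffineForm R d)

theorem eval_eq (f : AffineForm R d) (z : Fin d → F) :
    f.eval z = algebraMap R F f.const + f.linearPart F z := by
  rw [eval, linearPart_apply]

theorem eval_add (f : AffineForm R d) (z w : Fin d → F) :
    f.eval (z + w) = f.eval z + f.linearPart F w := by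
  rw [eval_eq, eval_eq, map_add, add_assoc]

/-- The common zero set of the forms indexed by `B`. -/
def zeroSet (B : Finset ι) : AffineSubspace F (Fin d → F) := B.inf fun i => (L i).zeroLocus F

theorem mem_zeroSet (B : Finset ι) (z : Fin d → F) :
    z ∈ zeroSet F L B ↔ ∀ i ∈ B, (L i).eval z = 0 := by
  classical
  induction B using Finset.induction_on with
  | empty => simp [zeroSet]
  | insert i B _ ih =>
    rw [zeroSet, Finset.inf_insert, AffineSubspace.mem_inf_iff, Finset.forall_mem_insert,
      mem_zeroLocus, ← ih, zeroSet]

theorem le_zeroSet_iff (B : Finset ι) (x : AffineSubspace F (Fin d → F)) :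
    x ≤ zeroSet F L B ↔ ∀ i ∈ B, x ≤ (L i).zeroLocus F := Finset.le_inf_iff

/-- The linear parts of the forms indexed by `B` are linearly independent. -/
def IsIndep (B : Finset ι) : Prop := LinearIndependent F fun i : B => (L i).linearPart F

theorem direction_zeroSet {B : Finset ι} (h : (zeroSet F L B : Set (Fin d → F)).Nonempty) :
    (zeroSet F L B).direction = LinearMap.ker (LinearMap.pi fun i : B => (L i).linearPart F) := by
  obtain ⟨p, hp⟩ := h
  ext v
  rw [← AffineSubspace.vadd_mem_iff_mem_direction v hp, mem_zeroSet, LinearMap.mem_ker]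
  have hp' := (mem_zeroSet F L B p).1 hp
  constructor
  · intro h
    funext i
    have := h i i.2
    rw [vadd_eq_add, add_comm, eval_add, hp' i i.2, zero_add] at this
    exact this
  · intro h i hi
    rw [vadd_eq_add, add_comm, eval_add, hp' i hi, zero_add]
    exact congrFun h ⟨i, hi⟩

variable {F L}

theorem IsIndep.exists_eval_eq {B : Finset ι} (h : IsIndep F L B) (u : ι → F) :
    ∃ z : Fin d → F, ∀ i ∈ B, (L i).eval z = u i := by
  obtain ⟨z, hz⟩ := (linearIndependent_iff_pi_surjective _).1 h
    fun i => u i - algebraMap R F (L i).const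
  refine ⟨z, fun i hi => ?_⟩
  have := congrFun hz ⟨i, hi⟩
  simp only [LinearMap.pi_apply] at this
  rw [eval_eq, this]; ring

theorem IsIndep.nonempty {B : Finset ι} (h : IsIndep F L B) :
    (zeroSet F L B : Set (Fin d → F)).Nonempty := by
  obtain ⟨z, hz⟩ := h.exists_eval_eq 0
  exact ⟨z, (mem_zeroSet F L B z).2 hz⟩

theorem isIndep_iff_finrank {B : Finset ι} (h : (zeroSet F L B : Set (Fin d → F)).Nonempty) :
    IsIndep F L B ↔ Module.finrank F (zeroSet F L B).direction + B.card = d := by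
  rw [direction_zeroSet F L h, IsIndep, linearIndependent_iff_pi_surjective]
  have h1 := LinearMap.finrank_range_add_finrank_ker
    (LinearMap.pi fun i : B => (L i).linearPart F)
  rw [Module.finrank_fin_fun] at h1
  constructor
  · intro hs
    rw [LinearMap.range_eq_top.2 hs, finrank_top, Module.finrank_fintype_fun_eq_card,
      Fintype.card_coe] at h1
    omega
  · intro h2
    rw [← LinearMap.range_eq_top]
    apply Submodule.eq_top_of_finrank_eq
    rw [Module.finrank_fintype_fun_eq_card, Fintype.card_coe]
    omega

/-- A form that vanishes on the common zeros of an independent family is a combination of it. -/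
theorem IsIndep.exists_combination {B : Finset ι} (h : IsIndep F L B) {i : ι}
    (hi : zeroSet F L B ≤ (L i).zeroLocus F) :
    ∃ g : ι → F, (∀ j, algebraMap R F ((L i).coeff j) = ∑ b ∈ B, g b * algebraMap R F ((L b).coeff j))
      ∧ algebraMap R F (L i).const = ∑ b ∈ B, g b * algebraMap R F (L b).const := by
  classical
  have h1 : (L i).linearPart F ∈ Submodule.span F (Set.range fun b : B => (L b).linearPart F) := by
    apply mem_span_of_iInf_ker_le_ker
    rw [← LinearMap.ker_pi, ← direction_zeroSet F L h.nonempty]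
    obtain ⟨p, hp⟩ := h.nonempty
    intro v hv
    have h2 : (L i).eval (v +ᵥ p) = 0 := hi (AffineSubspace.vadd_mem_of_mem_direction hv hp)
    have h3 : (L i).eval p = 0 := hi hp
    rw [vadd_eq_add, add_comm, eval_add, h3, zero_add] at h2
    exact h2
  obtain ⟨g, hg⟩ := (Submodule.mem_span_range_iff_exists_fun F).1 h1
  refine ⟨fun b => if hb : b ∈ B then g ⟨b, hb⟩ else 0, ?_⟩
  have hlin : ∀ v, (L i).linearPart F v = ∑ b ∈ B,
      (if hb : b ∈ B then g ⟨b, hb⟩ else 0) * (L b).linearPart F v := by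
    intro v
    rw [← hg, LinearMap.sum_apply]
    refine Eq.trans (Finset.sum_congr rfl fun b _ => ?_) (Finset.sum_coe_sort B _)
    simp
  constructor
  · intro j
    have := hlin (Pi.single j 1)
    simpa [linearPart_apply, Pi.single_apply] using this
  · obtain ⟨p, hp⟩ := h.nonempty
    have h3 : (L i).eval p = 0 := hi hp
    have h4 := (mem_zeroSet F L B p).1 hp
    rw [eval_eq, hlin] at h3
    rw [eq_neg_of_add_eq_zero_left h3, ← Finset.sum_neg_distrib]
    refine Finset.sum_congr rfl fun b hb => ?_
    have := h4 b hb
    rw [eval_eq] at this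
    rw [eq_neg_of_add_eq_zero_left this, mul_neg]

end Linear

section Relations

variable {R : Type*} [CommRing R] {d : ℕ} {ι : Type*} {L : ι → AffineForm R d}

theorem sum_smul_linearPart_eq_zero {F : Type*} [Field F] [Algebra R F] {B : Finset ι} {c : ι → R}
    (hc : ∀ j, algebraMap R F (∑ b ∈ B, c b * (L b).coeff j) = 0) :
    ∑ b ∈ B, algebraMap R F (c b) • (L b).linearPart F = 0 := by
  refine LinearMap.ext fun v => ?_
  rw [LinearMap.sum_apply]
  simp only [LinearMap.smul_apply, linearPart_apply, smul_eq_mul, LinearMap.zero_apply,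
    Finset.mul_sum]
  rw [Finset.sum_comm]
  refine Finset.sum_eq_zero fun j _ => ?_
  have := hc j
  rw [map_sum] at this
  simp_rw [← mul_assoc, ← Finset.sum_mul, ← map_mul]
  rw [this, zero_mul]

theorem IsIndep.map_eq_zero {F : Type*} [Field F] [Algebra R F] {B : Finset ι}
    (h : IsIndep F L B) {c : ι → R}
    (hc : ∀ j, algebraMap R F (∑ b ∈ B, c b * (L b).coeff j) = 0) :
    ∀ b ∈ B, algebraMap R F (c b) = 0 := by
  intro b hb
  have h1 := sum_smul_linearPart_eq_zero (F := F) hc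
  rw [← Finset.sum_coe_sort] at h1
  exact Fintype.linearIndependent_iff.1 h _ h1 ⟨b, hb⟩

variable [IsDedekindDomain R] {K : Type*} [Field K] [Algebra R K] [IsFractionRing R K]
  {k : Type*} [Field k] [Algebra R k]

/-- A tuple in the fraction field can be scaled to a tuple in the Dedekind domain that does not
vanish identically in a given field. -/
theorem exists_scaling {J : Type*} (s : Finset J) (f : J → K) {j : J} (hj : j ∈ s) (hf : f j ≠ 0) :
    ∃ a : K, ∃ c : J → R, (∀ i ∈ s, algebraMap R K (c i) = a * f i) ∧
      ∃ i ∈ s, algebraMap R k (c i) ≠ 0 := by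
  classical
  obtain ⟨a, ha, i, hi, hai⟩ := Ideal.exist_integer_multiples_notMem (A := R) (K := K)
    (RingHom.ker_ne_top (algebraMap R k)) s f hj hf
  choose! c hc using ha
  refine ⟨a, c, hc, i, hi, fun h => hai ?_⟩
  rw [← hc i hi]
  exact FractionalIdeal.mem_coeIdeal_of_mem _ h

theorem IsIndep.of_residue {B : Finset ι} (h : IsIndep k L B) : IsIndep K L B := by
  classical
  rw [IsIndep, Fintype.linearIndependent_iff]
  intro g hg
  by_contra hne
  push Not at hne
  obtain ⟨⟨b, hb⟩, hgb⟩ := hne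
  obtain ⟨a, c, hc, i, hi, hci⟩ := exists_scaling (R := R) (k := k) B
    (fun b => if hb : b ∈ B then g ⟨b, hb⟩ else 0) hb (by simpa [hb] using hgb)
  refine hci (h.map_eq_zero ?_ i hi)
  intro j
  refine (congrArg (algebraMap R k) ?_).trans (map_zero _)
  apply IsFractionRing.injective R K
  rw [map_sum, map_zero]
  have h1 := LinearMap.congr_fun hg (Pi.single j 1)
  rw [LinearMap.sum_apply] at h1
  have h2 : ∑ b ∈ B, (if hb : b ∈ B then g ⟨b, hb⟩ else 0) * algebraMap R K ((L b).coeff j) = 0 := by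
    rw [← Finset.sum_coe_sort]
    simpa [linearPart_apply, Pi.single_apply] using h1
  rw [← mul_zero a, ← h2, Finset.mul_sum]
  refine Finset.sum_congr rfl fun b hb => ?_
  rw [map_mul, hc b hb, mul_assoc]

/-- A form over `R` that vanishes on the common zeros over the fraction field of a family that is
independent over `k` satisfies a relation over `R` with a leading coefficient nonzero in `k`. -/
theorem IsIndep.exists_relation {B : Finset ι} (h : IsIndep k L B) {i : ι}
    (hi : zeroSet K L B ≤ (L i).zeroLocus K) :
    ∃ (a : R) (c : ι → R), algebraMap R k a ≠ 0 ∧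
      (∀ j, a * (L i).coeff j = ∑ b ∈ B, c b * (L b).coeff j) ∧
      a * (L i).const = ∑ b ∈ B, c b * (L b).const := by
  classical
  obtain ⟨g, hg1, hg2⟩ := (h.of_residue (K := K)).exists_combination hi
  obtain ⟨a, c, hc, o, ho, hco⟩ := exists_scaling (R := R) (k := k) (Finset.insertNone B)
    (fun o : Option ι => o.elim 1 g) (j := none) (by simp) one_ne_zero
  have hcn : algebraMap R K (c none) = a := by simpa using hc none (by simp)
  have hcb : ∀ b ∈ B, algebraMap R K (c (some b)) = a * g b := fun b hb => by
    simpa using hc (some b) (by simpa using hb)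
  have hinj := IsFractionRing.injective R K
  have h1 : ∀ j, c none * (L i).coeff j = ∑ b ∈ B, c (some b) * (L b).coeff j := by
    intro j
    apply hinj
    rw [map_mul, hcn, hg1, map_sum, Finset.mul_sum]
    refine Finset.sum_congr rfl fun b hb => ?_
    rw [map_mul, hcb b hb, mul_assoc]
  have h2 : c none * (L i).const = ∑ b ∈ B, c (some b) * (L b).const := by
    apply hinj
    rw [map_mul, hcn, hg2, map_sum, Finset.mul_sum]
    refine Finset.sum_congr rfl fun b hb => ?_
    rw [map_mul, hcb b hb, mul_assoc]
  refine ⟨c none, fun b => c (some b), fun h0 => hco ?_, h1, h2⟩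
  cases o with
  | none => exact h0
  | some b =>
    refine h.map_eq_zero (c := fun b => c (some b)) (fun j => ?_) b (by simpa using ho)
    rw [← h1, map_mul, h0, zero_mul]

omit [IsDedekindDomain R] in
theorem mul_eval_of_relation {S : Type*} [CommRing S] [Algebra R S] {B : Finset ι} {i : ι} {a : R}
    {c : ι → R} (h1 : ∀ j, a * (L i).coeff j = ∑ b ∈ B, c b * (L b).coeff j)
    (h2 : a * (L i).const = ∑ b ∈ B, c b * (L b).const) (z : Fin d → S) :
    algebraMap R S a * (L i).eval z = ∑ b ∈ B, algebraMap R S (c b) * (L b).eval z := by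
  simp only [eval, mul_add, Finset.mul_sum, Finset.sum_add_distrib]
  congr 1
  · rw [← map_mul, h2, map_sum]; simp
  · rw [Finset.sum_comm]
    refine Finset.sum_congr rfl fun j _ => ?_
    simp_rw [← mul_assoc, ← map_mul]
    rw [h1, map_sum, Finset.sum_mul]

end Relations

end AffineForm

namespace Arrangement

variable {k V : Type*} [Field k] [AddCommGroup V] [Module k V] [FiniteDimensional k V]

theorem isAtom_iff_mem_members (A : Arrangement k V) (x : A.IntPoset) :
    IsAtom x ↔ x.1 ∈ A.members := by
  classical
  constructor
  · intro h
    obtain ⟨hne, S, hS, hx⟩ := x.2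
    have hSne : S.Nonempty := by
      rw [Finset.nonempty_iff_ne_empty]
      rintro rfl
      exact h.1 (Subtype.ext (hx.trans (by rw [Finset.inf_empty, inf_top_eq]; rfl)))
    obtain ⟨H, hH⟩ := hSne
    have hxH : x.1 ≤ H := hx.le.trans (inf_le_right.trans (Finset.inf_le hH))
    have hflat : A.IsFlat H := ⟨A.nonempty H (hS hH), {H}, by simpa using hS hH, by
      simpa using A.le_ambient H (hS hH)⟩
    set h' : A.IntPoset := ⟨H, hflat⟩ with hh'
    have hHbot : h' ≠ ⊥ := by
      intro e
      have h1 : H = A.ambient := congrArg Subtype.val e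
      have h2 := A.finrank_add_one H (hS hH)
      rw [h1] at h2
      omega
    have hle : h' ≤ x := hxH
    rw [← (h.le_iff.1 hle).resolve_left hHbot]
    exact hS hH
  · intro h
    have h1 := A.finrank_add_one x.1 h
    have h2 := finrank_add_codim A x
    refine ⟨?_, fun y hy => ?_⟩
    · rintro rfl
      rw [codim_bot] at h2
      omega
    · by_contra hne
      have h3 := A.codim_strictMono hy
      have h4 := A.codim_strictMono (bot_lt_iff_ne_bot.2 hne)
      omega

end Arrangement

namespace AffineForm

section Flats

variable {R : Type*} [CommRing R] {d : ℕ} {ι : Type*} [Fintype ι] {F : Type*} [Field F]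
  [Algebra R F] {L : ι → AffineForm R d}

theorem isFlat_arrangement_iff (hn : ∀ i, (L i).IsNonconstant F)
    (x : AffineSubspace F (Fin d → F)) :
    (arrangement F L).IsFlat x ↔ (x : Set (Fin d → F)).Nonempty ∧ ∃ B, x = zeroSet F L B := by
  classical
  refine and_congr_right fun _ => ⟨?_, ?_⟩
  · rintro ⟨S, hS, rfl⟩
    refine ⟨Finset.univ.filter fun i => (L i).zeroLocus F ∈ S, le_antisymm ?_ ?_⟩
    · refine (le_zeroSet_iff _ _ _ _).2 fun i hi => inf_le_right.trans ?_
      exact Finset.inf_le (f := id) (Finset.mem_filter.1 hi).2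
    · refine le_inf le_top (Finset.le_inf fun H hH => ?_)
      obtain ⟨i, -, rfl⟩ := Finset.mem_image.1 (hS hH)
      exact Finset.inf_le (f := fun i => (L i).zeroLocus F)
        (Finset.mem_filter.2 ⟨Finset.mem_univ _, hH⟩)
  · rintro ⟨B, rfl⟩
    refine ⟨B.image fun i => (L i).zeroLocus F, ?_, ?_⟩
    · intro H hH
      obtain ⟨i, -, rfl⟩ := Finset.mem_image.1 hH
      exact Finset.mem_image_of_mem _ (Finset.mem_filter.2 ⟨Finset.mem_univ _, hn i⟩)
    · rw [Finset.inf_image]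
      exact (top_inf_eq _).symm

theorem zeroLocus_mem_members (hn : ∀ i, (L i).IsNonconstant F) (i : ι) :
    (L i).zeroLocus F ∈ (arrangement F L).members := by
  classical
  exact Finset.mem_image_of_mem _ (Finset.mem_filter.2 ⟨Finset.mem_univ _, hn i⟩)

/-- The hyperplane `V(L i)` as a flat. -/
def hyperplane (hn : ∀ i, (L i).IsNonconstant F) (i : ι) : (arrangement F L).IntPoset :=
  ⟨(L i).zeroLocus F, (isFlat_arrangement_iff hn _).2 ⟨(hn i).nonempty, {i}, by simp [zeroSet]⟩⟩

theorem isLUB_hyperplane_iff (hn : ∀ i, (L i).IsNonconstant F) (B : Finset ι)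
    (x : (arrangement F L).IntPoset) :
    IsLUB (hyperplane hn '' B) x ↔ x.1 = zeroSet F L B := by
  have hub : ∀ y : (arrangement F L).IntPoset,
      y ∈ upperBounds (hyperplane hn '' B) ↔ y.1 ≤ zeroSet F L B := by
    intro y
    rw [le_zeroSet_iff, mem_upperBounds, Set.forall_mem_image]
    rfl
  constructor
  · intro h
    have h1 := (hub x).1 h.1
    have h2 : (arrangement F L).IsFlat (zeroSet F L B) :=
      (isFlat_arrangement_iff hn _).2 ⟨x.2.1.mono h1, B, rfl⟩
    exact le_antisymm h1 (h.2 ((hub ⟨_, h2⟩).2 le_rfl))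
  · intro h
    refine ⟨(hub x).2 h.le, fun y hy => ?_⟩
    exact ((hub y).1 hy).trans h.ge

theorem finrank_add_codim_arrangement (x : (arrangement F L).IntPoset) :
    Module.finrank F x.1.direction + (arrangement F L).codim x = d := by
  have := (arrangement F L).finrank_add_codim x
  have h : (arrangement F L).ambient = ⊤ := rfl
  rwa [h, AffineSubspace.direction_top, finrank_top, Module.finrank_fin_fun] at this

theorem isIndep_iff_exists_isLUB (hn : ∀ i, (L i).IsNonconstant F) (B : Finset ι) :
    IsIndep F L B ↔ ∃ x, IsLUB (hyperplane hn '' B) x ∧ Order.height x = B.card := by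
  have key : ∀ x : (arrangement F L).IntPoset, x.1 = zeroSet F L B →
      (IsIndep F L B ↔ Order.height x = B.card) := by
    intro x hx
    rw [isIndep_iff_finrank (hx ▸ x.2.1), ← hx, Arrangement.height_eq_codim]
    have := finrank_add_codim_arrangement x
    norm_cast
    omega
  constructor
  · intro h
    let x : (arrangement F L).IntPoset :=
      ⟨zeroSet F L B, (isFlat_arrangement_iff hn _).2 ⟨h.nonempty, B, rfl⟩⟩
    exact ⟨x, (isLUB_hyperplane_iff hn B x).2 rfl, (key x rfl).1 h⟩
  · rintro ⟨x, hx, hc⟩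
    exact (key x ((isLUB_hyperplane_iff hn B x).1 hx)).2 hc

theorem isIndep_and_le_iff_exists_isLUB (hn : ∀ i, (L i).IsNonconstant F) (B : Finset ι) (i : ι) :
    (IsIndep F L B ∧ zeroSet F L B ≤ (L i).zeroLocus F) ↔
      ∃ x, IsLUB (hyperplane hn '' B) x ∧ Order.height x = B.card ∧ hyperplane hn i ≤ x := by
  rw [isIndep_iff_exists_isLUB hn]
  constructor
  · rintro ⟨⟨x, hx, hc⟩, h⟩
    exact ⟨x, hx, hc, ((isLUB_hyperplane_iff hn B x).1 hx).le.trans h⟩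
  · rintro ⟨x, hx, hc, h⟩
    exact ⟨⟨x, hx, hc⟩, ((isLUB_hyperplane_iff hn B x).1 hx).ge.trans h⟩

theorem exists_basis {T : Finset ι} {p : Fin d → F} (hp : ∀ i ∈ T, (L i).eval p = 0) :
    ∃ B ⊆ T, IsIndep F L B ∧ ∀ i ∈ T, zeroSet F L B ≤ (L i).zeroLocus F := by
  classical
  obtain ⟨b, hbT, -, hspan, hind⟩ := exists_linearIndepOn_extension
    (v := fun i : ι => (L i).linearPart F) (linearIndepOn_empty F _) (Set.empty_subset (T : Set ι))
  obtain ⟨B, rfl⟩ : ∃ B : Finset ι, (B : Set ι) = b := ⟨b.toFinset, by simp⟩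
  refine ⟨B, by exact_mod_cast hbT, hind, fun i hi z hz => ?_⟩
  have hz' := (mem_zeroSet F L B z).1 hz
  have hzero : ∀ φ ∈ Submodule.span F ((fun i : ι => (L i).linearPart F) '' B), φ (z - p) = 0 := by
    intro φ hφ
    induction hφ using Submodule.span_induction with
    | mem φ h =>
      obtain ⟨b, hb, rfl⟩ := h
      have h1 := hz' b hb
      have h2 := hp b (hbT hb)
      rw [eval_eq] at h1 h2
      simp only [map_sub]
      linear_combination h1 - h2
    | zero => simp
    | add φ ψ _ _ h1 h2 => simp only [LinearMap.add_apply, h1, h2, add_zero]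
    | smul c φ _ h => simp only [LinearMap.smul_apply, h, smul_zero]
  have h3 := hzero _ (hspan ⟨i, hi, rfl⟩)
  have h4 := hp i hi
  rw [mem_zeroLocus]
  rw [eval_eq] at h4 ⊢
  simp only [map_sub] at h3
  linear_combination h3 + h4

end Flats

section GoodReduction

variable {R : Type*} [CommRing R] [IsDedekindDomain R] {d : ℕ} {ι : Type*} [Fintype ι]
  {K : Type*} [Field K] [Algebra R K] [IsFractionRing R K] {k : Type*} [Field k] [Algebra R k]
  {L : ι → AffineForm R d}

omit [IsDedekindDomain R] [IsFractionRing R K] in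
theorem isNonconstant_of_orderIso (hn : ∀ i, (L i).IsNonconstant K)
    (hinj : Function.Injective fun i => (L i).zeroLocus K)
    (e : (arrangement K L).IntPoset ≃o (arrangement k L).IntPoset) :
    (∀ i, (L i).IsNonconstant k) ∧ Function.Injective fun i => (L i).zeroLocus k := by
  classical
  have hf : ∀ i, ∃ j, (L j).IsNonconstant k ∧ (L j).zeroLocus k = (e (hyperplane hn i)).1 := by
    intro i
    have h1 : IsAtom (hyperplane hn i) :=
      ((arrangement K L).isAtom_iff_mem_members _).2 (zeroLocus_mem_members hn i)
    have h2 := ((arrangement k L).isAtom_iff_mem_members _).1 ((e.isAtom_iff _).2 h1)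
    obtain ⟨j, hj, h⟩ := Finset.mem_image.1 h2
    exact ⟨j, (Finset.mem_filter.1 hj).2, h⟩
  choose f hf1 hf2 using hf
  have hfinj : Function.Injective fun i => (L (f i)).zeroLocus k := by
    intro i j h
    have h' : (L (f i)).zeroLocus k = (L (f j)).zeroLocus k := h
    rw [hf2, hf2] at h'
    exact hinj (congrArg Subtype.val (e.injective (Subtype.ext h')))
  have hfs : Function.Surjective f := Finite.surjective_of_injective fun i j h => hfinj (by
    change (L (f i)).zeroLocus k = (L (f j)).zeroLocus k
    rw [h])
  refine ⟨fun i => ?_, fun i j h => ?_⟩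
  · obtain ⟨j, rfl⟩ := hfs i
    exact hf1 j
  · obtain ⟨i, rfl⟩ := hfs i
    obtain ⟨j, rfl⟩ := hfs j
    rw [hfinj h]

omit [IsDedekindDomain R] [IsFractionRing R K] in
theorem exists_perm_of_orderIso (hn : ∀ i, (L i).IsNonconstant K)
    (hn' : ∀ i, (L i).IsNonconstant k) (hinj : Function.Injective fun i => (L i).zeroLocus K)
    (e : (arrangement K L).IntPoset ≃o (arrangement k L).IntPoset) :
    ∃ σ : ι ≃ ι, ∀ i, e (hyperplane hn i) = hyperplane hn' (σ i) := by
  classical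
  have hf : ∀ i, ∃ j, e (hyperplane hn i) = hyperplane hn' j := by
    intro i
    have h1 : IsAtom (hyperplane hn i) :=
      ((arrangement K L).isAtom_iff_mem_members _).2 (zeroLocus_mem_members hn i)
    have h2 := ((arrangement k L).isAtom_iff_mem_members _).1 ((e.isAtom_iff _).2 h1)
    obtain ⟨j, -, h⟩ := Finset.mem_image.1 h2
    exact ⟨j, Subtype.ext h.symm⟩
  choose f hf using hf
  have hfi : Function.Injective f := fun i j h => hinj (congrArg Subtype.val
    (e.injective ((hf i).trans ((congrArg _ h).trans (hf j).symm))))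
  exact ⟨Equiv.ofBijective f ⟨hfi, Finite.surjective_of_injective hfi⟩, hf⟩

omit [Fintype ι] in
theorem isLUB_map_iff {P Q : Type*} [PartialOrder P] [PartialOrder Q] (e : P ≃o Q) {f : ι → P}
    {g : ι → Q} {σ : ι ≃ ι} (h : ∀ i, e (f i) = g (σ i)) (B : Finset ι) (x : P) :
    IsLUB (g '' (B.map σ.toEmbedding)) (e x) ↔ IsLUB (f '' B) x := by
  have : g '' (B.map σ.toEmbedding) = e '' (f '' B) := by
    rw [Finset.coe_map, Set.image_image, Set.image_image]
    exact Set.image_congr fun i _ => (h i).symm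
  rw [this, e.isLUB_image']

theorem isIndep_residue_iff (hn : ∀ i, (L i).IsNonconstant K)
    (hinj : Function.Injective fun i => (L i).zeroLocus K)
    (e : (arrangement K L).IntPoset ≃o (arrangement k L).IntPoset) (B : Finset ι) :
    IsIndep k L B ↔ IsIndep K L B := by
  classical
  obtain ⟨hn', -⟩ := isNonconstant_of_orderIso hn hinj e
  obtain ⟨σ, hσ⟩ := exists_perm_of_orderIso hn hn' hinj e
  have h1 : ∀ B, IsIndep K L B ↔ IsIndep k L (B.map σ.toEmbedding) := by
    intro B
    rw [isIndep_iff_exists_isLUB hn, isIndep_iff_exists_isLUB hn']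
    refine e.toEquiv.exists_congr fun x => ?_
    change _ ↔ IsLUB _ (e x) ∧ Order.height (e x) = _
    rw [isLUB_map_iff e hσ, Order.height_orderIso, Finset.card_map]
  have h2 : (Finset.univ.filter fun B => IsIndep k L B) =
      Finset.univ.filter fun B => IsIndep K L B := by
    refine Finset.eq_of_subset_of_card_le ?_ ?_
    · exact Finset.monotone_filter_right _ fun B _ h => h.of_residue
    · refine Finset.card_le_card_of_injOn (fun B => B.map σ.toEmbedding) ?_ ?_
      · intro B hB
        simpa [h1] using hB
      · exact fun B _ C _ h => Finset.map_injective _ h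
  simpa using Finset.ext_iff.1 h2 B

theorem zeroSet_le_residue_iff (hn : ∀ i, (L i).IsNonconstant K)
    (hinj : Function.Injective fun i => (L i).zeroLocus K)
    (e : (arrangement K L).IntPoset ≃o (arrangement k L).IntPoset) {B : Finset ι}
    (hB : IsIndep k L B) (i : ι) :
    zeroSet k L B ≤ (L i).zeroLocus k ↔ zeroSet K L B ≤ (L i).zeroLocus K := by
  classical
  obtain ⟨hn', -⟩ := isNonconstant_of_orderIso hn hinj e
  obtain ⟨σ, hσ⟩ := exists_perm_of_orderIso hn hn' hinj e
  have h1 : ∀ (B : Finset ι) (i : ι), (IsIndep K L B ∧ zeroSet K L B ≤ (L i).zeroLocus K) ↔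
      (IsIndep k L (B.map σ.toEmbedding) ∧
        zeroSet k L (B.map σ.toEmbedding) ≤ (L (σ i)).zeroLocus k) := by
    intro B i
    rw [isIndep_and_le_iff_exists_isLUB hn, isIndep_and_le_iff_exists_isLUB hn']
    refine e.toEquiv.exists_congr fun x => ?_
    change _ ↔ IsLUB _ (e x) ∧ Order.height (e x) = _ ∧ _ ≤ e x
    rw [isLUB_map_iff e hσ, Order.height_orderIso, Finset.card_map, ← hσ, e.le_iff_le]
  have h2 : (Finset.univ.filter fun p : Finset ι × ι =>
        IsIndep K L p.1 ∧ zeroSet K L p.1 ≤ (L p.2).zeroLocus K) =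
      Finset.univ.filter fun p : Finset ι × ι =>
        IsIndep k L p.1 ∧ zeroSet k L p.1 ≤ (L p.2).zeroLocus k := by
    refine Finset.eq_of_subset_of_card_le ?_ ?_
    · refine Finset.monotone_filter_right _ fun p _ h => ?_
      have hp := (isIndep_residue_iff hn hinj e _).2 h.1
      obtain ⟨a, c, ha, hc1, hc2⟩ := hp.exists_relation h.2
      refine ⟨hp, fun z hz => ?_⟩
      have h3 := mul_eval_of_relation hc1 hc2 z
      rw [Finset.sum_eq_zero fun b hb => by rw [(mem_zeroSet k L _ z).1 hz b hb, mul_zero]] at h3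
      exact (mul_eq_zero.1 h3).resolve_left ha
    · refine Finset.card_le_card_of_injOn
        (fun p => (p.1.map σ.symm.toEmbedding, σ.symm p.2)) ?_ ?_
      · rintro ⟨B, i⟩ hp
        have : (B.map σ.symm.toEmbedding).map σ.toEmbedding = B := by
          rw [Finset.map_map]; simp
        simp only [Finset.coe_filter, Finset.mem_univ, true_and, Set.mem_ofPred_eq] at hp ⊢
        rw [h1, this, σ.apply_symm_apply]
        exact hp
      · rintro ⟨B, i⟩ - ⟨C, j⟩ - h
        simp only [Prod.mk.injEq] at h
        rw [Finset.map_injective _ h.1, σ.symm.injective h.2]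
  have := Finset.ext_iff.1 h2 (B, i)
  simp only [Finset.mem_filter, Finset.mem_univ, true_and] at this
  have hB' := (isIndep_residue_iff hn hinj e B).1 hB
  exact ⟨fun h => (this.2 ⟨hB, h⟩).2, fun h => (this.1 ⟨hB', h⟩).2⟩

open Classical in
/-- The indices of the hyperplanes that contain `x`. -/
def support (L : ι → AffineForm R d) (x : AffineSubspace K (Fin d → K)) : Finset ι :=
  Finset.univ.filter fun i => x ≤ (L i).zeroLocus K

omit [IsDedekindDomain R] [IsFractionRing R K] in
theorem mem_support (x : AffineSubspace K (Fin d → K)) (i : ι) :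
    i ∈ support L x ↔ x ≤ (L i).zeroLocus K := by simp [support]

omit [IsDedekindDomain R] [IsFractionRing R K] in
theorem zeroSet_support (hn : ∀ i, (L i).IsNonconstant K) (x : (arrangement K L).IntPoset) :
    zeroSet K L (support L x.1) = x.1 := by
  obtain ⟨-, B, hB⟩ := (isFlat_arrangement_iff hn x.1).1 x.2
  refine le_antisymm ?_ ((le_zeroSet_iff _ _ _ _).2 fun i hi => (mem_support _ _).1 hi)
  conv_rhs => rw [hB]
  refine (le_zeroSet_iff _ _ _ _).2 fun i hi => ?_
  refine Finset.inf_le (f := fun i => (L i).zeroLocus K) ((mem_support _ _).2 ?_)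
  rw [hB]
  exact Finset.inf_le (f := fun i => (L i).zeroLocus K) hi

omit [IsDedekindDomain R] [IsFractionRing R K] in
theorem support_subset_iff (hn : ∀ i, (L i).IsNonconstant K) (x y : (arrangement K L).IntPoset) :
    support L x.1 ⊆ support L y.1 ↔ x ≤ y := by
  constructor
  · intro h
    change y.1 ≤ x.1
    rw [← zeroSet_support hn x, le_zeroSet_iff]
    exact fun i hi => (mem_support _ _).1 (h hi)
  · exact fun h i hi => (mem_support _ _).2 (le_trans h ((mem_support _ _).1 hi))

omit [IsDedekindDomain R] [IsFractionRing R K] in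
theorem exists_support_eq_inter (hn : ∀ i, (L i).IsNonconstant K)
    (x y : (arrangement K L).IntPoset) :
    ∃ z : (arrangement K L).IntPoset, ∀ i, i ∈ support L z.1 ↔
      i ∈ support L x.1 ∧ i ∈ support L y.1 := by
  classical
  have hx : x.1 ≤ zeroSet K L (support L x.1 ∩ support L y.1) :=
    (le_zeroSet_iff _ _ _ _).2 fun i hi => (mem_support _ _).1 (Finset.mem_inter.1 hi).1
  have hy : y.1 ≤ zeroSet K L (support L x.1 ∩ support L y.1) :=
    (le_zeroSet_iff _ _ _ _).2 fun i hi => (mem_support _ _).1 (Finset.mem_inter.1 hi).2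
  refine ⟨⟨_, (isFlat_arrangement_iff hn _).2 ⟨x.2.1.mono hx, _, rfl⟩⟩, fun i => ?_⟩
  simp only [mem_support]
  constructor
  · exact fun h => ⟨hx.trans h, hy.trans h⟩
  · rintro ⟨h1, h2⟩
    exact Finset.inf_le (f := fun i => (L i).zeroLocus K)
      (Finset.mem_inter.2 ⟨(mem_support _ _).2 h1, (mem_support _ _).2 h2⟩)

/-- Under good reduction the forms that vanish at a point over the residue field are those that
vanish on some flat. -/
theorem exists_flat_of_residue_point (hn : ∀ i, (L i).IsNonconstant K)
    (hinj : Function.Injective fun i => (L i).zeroLocus K)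
    (e : (arrangement K L).IntPoset ≃o (arrangement k L).IntPoset) (p : Fin d → k) :
    ∃ x : (arrangement K L).IntPoset, ∀ i, (L i).eval p = 0 ↔ i ∈ support L x.1 := by
  classical
  obtain ⟨B, hBT, hB, hT⟩ := exists_basis (L := L) (p := p)
    (T := Finset.univ.filter fun i => (L i).eval p = 0) (by simp)
  refine ⟨⟨zeroSet K L B, (isFlat_arrangement_iff hn _).2
    ⟨((isIndep_residue_iff hn hinj e B).1 hB).nonempty, B, rfl⟩⟩, fun i => ?_⟩
  rw [mem_support, ← zeroSet_le_residue_iff hn hinj e hB]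
  constructor
  · exact fun h => hT i (by simpa using h)
  · intro h
    exact h ((mem_zeroSet k L B p).2 fun b hb => by simpa using hBT hb)

theorem exists_basis_of_flat (hn : ∀ i, (L i).IsNonconstant K)
    (hinj : Function.Injective fun i => (L i).zeroLocus K)
    (e : (arrangement K L).IntPoset ≃o (arrangement k L).IntPoset)
    (x : (arrangement K L).IntPoset) :
    ∃ B ⊆ support L x.1, IsIndep k L B ∧ x.1 = zeroSet K L B ∧
      zeroSet k L B = zeroSet k L (support L x.1) := by
  obtain ⟨p, hp⟩ := x.2.1
  obtain ⟨B, hBT, hB, hT⟩ := exists_basis (F := K) (L := L) (p := p) (T := support L x.1)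
    fun i hi => (mem_support _ _).1 hi hp
  have hB' := (isIndep_residue_iff hn hinj e B).2 hB
  refine ⟨B, hBT, hB', ?_, ?_⟩
  · rw [← zeroSet_support hn x]
    exact le_antisymm (Finset.inf_mono hBT) ((le_zeroSet_iff _ _ _ _).2 hT)
  · refine le_antisymm ((le_zeroSet_iff _ _ _ _).2 fun i hi => ?_) (Finset.inf_mono hBT)
    exact (zeroSet_le_residue_iff hn hinj e hB' i).2 (hT i hi)

theorem natCard_zeroSet_support [Finite k] (hn : ∀ i, (L i).IsNonconstant K)
    (hinj : Function.Injective fun i => (L i).zeroLocus K)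
    (e : (arrangement K L).IntPoset ≃o (arrangement k L).IntPoset)
    (x : (arrangement K L).IntPoset) :
    Nat.card {p : Fin d → k // ∀ i ∈ support L x.1, (L i).eval p = 0} *
      Nat.card k ^ (arrangement K L).codim x = Nat.card k ^ d := by
  obtain ⟨B, -, hB, hx, hz⟩ := exists_basis_of_flat hn hinj e x
  obtain ⟨p, hp⟩ := hB.nonempty
  have h1 : {p : Fin d → k // ∀ i ∈ support L x.1, (L i).eval p = 0} ≃
      (zeroSet k L B).direction := by
    refine (Equiv.subtypeEquivRight fun q => ?_).trans
      ((Equiv.subtypeEquiv (Equiv.subRight p) fun q => ?_) :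
        {q // q ∈ zeroSet k L B} ≃ (zeroSet k L B).direction)
    · rw [hz, mem_zeroSet]
    · exact (AffineSubspace.vsub_right_mem_direction_iff_mem hp q).symm
  have hB' := (isIndep_residue_iff hn hinj e B).1 hB
  have h2 := (isIndep_iff_finrank hB.nonempty).1 hB
  have h3 := (isIndep_iff_finrank hB'.nonempty).1 hB'
  have h4 := finrank_add_codim_arrangement x
  rw [hx] at h4
  rw [Nat.card_congr h1, Module.natCard_eq_pow_finrank (K := k), ← pow_add]
  congr 1
  omega

end GoodReduction

section Lifting

variable {R : Type*} [CommRing R] {d : ℕ} {ι : Type*} {L : ι → AffineForm R d}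
  {𝔬 : Type*} [CommRing 𝔬] [IsLocalRing 𝔬] [Algebra R 𝔬]

theorem residue_eval (f : AffineForm R d) (z : Fin d → 𝔬) :
    residue 𝔬 (f.eval z) = f.eval fun j => residue 𝔬 (z j) := by
  simp only [eval, map_add, map_sum, map_mul]
  rfl

omit [IsLocalRing 𝔬] in
theorem eval_add_smul (f : AffineForm R d) (z w : Fin d → 𝔬) (c : 𝔬) :
    f.eval (z + c • w) = f.eval z + c * ∑ j, algebraMap R 𝔬 (f.coeff j) * w j := by
  simp only [eval, Pi.add_apply, Pi.smul_apply, smul_eq_mul, mul_add, Finset.sum_add_distrib,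
    Finset.mul_sum, add_assoc]
  congr 2
  exact Finset.sum_congr rfl fun j _ => by ring

/-- Common zeros over the residue field of an independent family lift. -/
theorem IsIndep.exists_lift {B : Finset ι} (hB : IsIndep (ResidueField 𝔬) L B)
    {p : Fin d → ResidueField 𝔬} (hp : ∀ b ∈ B, (L b).eval p = 0) :
    ∃ z : Fin d → 𝔬, (∀ j, residue 𝔬 (z j) = p j) ∧ ∀ b ∈ B, (L b).eval z = 0 := by
  classical
  have hsurj := residue_surjective (R := 𝔬)
  choose z₁ hz₁ using fun j => hsurj (p j)
  have hN : ∀ b : B, ∃ n : Fin d → 𝔬, ∀ b' : B,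
      residue 𝔬 (∑ j, algebraMap R 𝔬 ((L b').coeff j) * n j) = if b' = b then 1 else 0 := by
    intro b
    obtain ⟨v, hv⟩ := (linearIndependent_iff_pi_surjective _).1 hB (Pi.single b 1)
    choose n hn using fun j => hsurj (v j)
    refine ⟨n, fun b' => ?_⟩
    have := congrFun hv b'
    rw [LinearMap.pi_apply, linearPart_apply, Pi.single_apply] at this
    rw [← this, map_sum]
    refine Finset.sum_congr rfl fun j _ => ?_
    rw [map_mul, hn]; rfl
  choose n hn using hN
  let M : Matrix B B 𝔬 := fun b' b => ∑ j, algebraMap R 𝔬 ((L b').coeff j) * n b j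
  have hM : IsUnit M.det := by
    rw [← notMem_maximalIdeal, ← residue_eq_zero_iff, RingHom.map_det]
    have : (residue 𝔬).mapMatrix M = 1 := by
      ext b' b
      rw [RingHom.mapMatrix_apply, Matrix.map_apply, Matrix.one_apply]
      exact hn b b'
    rw [this, Matrix.det_one]
    exact one_ne_zero
  let u : B → 𝔬 := fun b => (L b).eval z₁
  have hu : ∀ b, residue 𝔬 (u b) = 0 := fun b => by
    rw [residue_eval]; simp only [hz₁]; exact hp b b.2
  let w : B → 𝔬 := M⁻¹.mulVec u
  have hw : M.mulVec w = u := by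
    rw [Matrix.mulVec_mulVec, Matrix.mul_nonsing_inv M hM, Matrix.one_mulVec]
  have hw0 : ∀ b, residue 𝔬 (w b) = 0 := fun b => by
    simp [w, Matrix.mulVec, dotProduct, hu]
  refine ⟨z₁ + (-1 : 𝔬) • fun j => ∑ b, n b j * w b, fun j => ?_, fun b hb => ?_⟩
  · simp [hw0, hz₁]
  · rw [eval_add_smul]
    have := congrFun hw ⟨b, hb⟩
    simp only [Matrix.mulVec, dotProduct, M, u] at this
    rw [← this]
    simp_rw [Finset.mul_sum, Finset.sum_mul]
    rw [Finset.sum_comm, ← Finset.sum_add_distrib]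
    refine Finset.sum_eq_zero fun j _ => ?_
    rw [← Finset.sum_add_distrib]
    exact Finset.sum_eq_zero fun b _ => by ring

theorem exists_lift_of_flat [IsDedekindDomain R] [Fintype ι] {K : Type*} [Field K] [Algebra R K]
    [IsFractionRing R K] (hn : ∀ i, (L i).IsNonconstant K)
    (hinj : Function.Injective fun i => (L i).zeroLocus K)
    (e : (arrangement K L).IntPoset ≃o (arrangement (ResidueField 𝔬) L).IntPoset)
    (x : (arrangement K L).IntPoset) {p : Fin d → ResidueField 𝔬}
    (hp : ∀ i ∈ support L x.1, (L i).eval p = 0) :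
    ∃ z : Fin d → 𝔬, (∀ j, residue 𝔬 (z j) = p j) ∧ ∀ i ∈ support L x.1, (L i).eval z = 0 := by
  obtain ⟨B, hBx, hB, hx, -⟩ := exists_basis_of_flat hn hinj e x
  obtain ⟨z, hz, hBz⟩ := hB.exists_lift fun b hb => hp b (hBx hb)
  refine ⟨z, hz, fun i hi => ?_⟩
  obtain ⟨a, c, ha, hc1, hc2⟩ := hB.exists_relation (hx ▸ (mem_support _ _).1 hi)
  have h := mul_eval_of_relation hc1 hc2 z
  rw [Finset.sum_eq_zero fun b hb => by rw [hBz b hb, mul_zero]] at h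
  have ha' : IsUnit (algebraMap R 𝔬 a) := by
    rw [← notMem_maximalIdeal, ← residue_eq_zero_iff]
    exact ha
  exact (ha'.mul_right_eq_zero).1 h

end Lifting

end AffineForm

section Topology

variable {𝔬 : Type*} [CommRing 𝔬] [TopologicalSpace 𝔬] [IsTopologicalRing 𝔬] [CompactSpace 𝔬]

theorem IsAdic.finite_quotient {I : Ideal 𝔬} (h : IsAdic I) (n : ℕ) : Finite (𝔬 ⧸ I ^ n) :=
  AddSubgroup.quotient_finite_of_isOpen (I ^ n).toAddSubgroup ((isAdic_iff.1 h).1 n)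

theorem IsAdic.secondCountableTopology {I : Ideal 𝔬} (h : IsAdic I) :
    SecondCountableTopology 𝔬 := by
  obtain ⟨ho, hs⟩ := isAdic_iff.1 h
  have hb : TopologicalSpace.IsTopologicalBasis
      (⋃ n : ℕ, Set.range fun x : 𝔬 ⧸ I ^ n => Ideal.Quotient.mk (I ^ n) ⁻¹' {x}) := by
    refine TopologicalSpace.isTopologicalBasis_of_isOpen_of_nhds ?_ ?_
    · intro u hu
      obtain ⟨n, x, rfl⟩ := Set.mem_iUnion.1 hu
      obtain ⟨a, rfl⟩ := Ideal.Quotient.mk_surjective x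
      have : Ideal.Quotient.mk (I ^ n) ⁻¹' {Ideal.Quotient.mk (I ^ n) a} =
          (fun b => b - a) ⁻¹' ((I ^ n : Ideal 𝔬) : Set 𝔬) := by
        ext b
        simp [Ideal.Quotient.eq]
      change IsOpen (Ideal.Quotient.mk (I ^ n) ⁻¹' {Ideal.Quotient.mk (I ^ n) a})
      rw [this]
      exact (ho n).preimage (continuous_id.sub continuous_const)
    · intro a u hau hu
      have h0 : (fun b => a + b) ⁻¹' u ∈ nhds (0 : 𝔬) :=
        (hu.preimage (continuous_const.add continuous_id)).mem_nhds (by simpa using hau)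
      obtain ⟨n, hn⟩ := hs _ h0
      refine ⟨_, Set.mem_iUnion.2 ⟨n, Ideal.Quotient.mk (I ^ n) a, rfl⟩, rfl, ?_⟩
      intro b hb
      have hb' : b - a ∈ I ^ n := by
        simpa [Ideal.Quotient.eq] using hb
      simpa using hn hb'
  refine hb.secondCountableTopology (Set.countable_iUnion fun n => ?_)
  have := h.finite_quotient n
  exact Set.countable_range _

variable [IsDomain 𝔬] [IsDiscreteValuationRing 𝔬]

omit [CompactSpace 𝔬] in
theorem IsAdic.t2Space (h : IsAdic (maximalIdeal 𝔬)) : T2Space 𝔬 := by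
  refine IsTopologicalAddGroup.t2Space_of_zero_sep fun x hx => ?_
  have h1 : x ∉ (⨅ n : ℕ, maximalIdeal 𝔬 ^ n) := by
    rw [Ideal.iInf_pow_eq_bot_of_isLocalRing _ (Ideal.IsPrime.ne_top inferInstance)]
    exact hx
  simp only [Submodule.mem_iInf, not_forall] at h1
  obtain ⟨n, hn⟩ := h1
  exact ⟨_, ((isAdic_iff.1 h).1 n).mem_nhds (zero_mem _), hn⟩

theorem IsAdic.finite_residueField (h : IsAdic (maximalIdeal 𝔬)) : Finite (ResidueField 𝔬) := by
  have := h.finite_quotient 1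
  rw [pow_one] at this
  exact this

end Topology

section AbsoluteValue

variable {𝔬 : Type*} [CommRing 𝔬] [IsDomain 𝔬] [IsDiscreteValuationRing 𝔬]

@[simp] theorem dvrAbs_zero : dvrAbs (0 : 𝔬) = 0 := by simp [dvrAbs]

theorem dvrAbs_of_ne_zero {a : 𝔬} (ha : a ≠ 0) : dvrAbs a =
    ((residueCard 𝔬 : NNReal)⁻¹) ^ (IsDiscreteValuationRing.addVal 𝔬 a).toNat := by
  simp [dvrAbs, ha]

theorem dvrAbs_uniformizer_mul {ϖ : 𝔬} (hϖ : Irreducible ϖ) (a : 𝔬) :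
    dvrAbs (ϖ * a) = (residueCard 𝔬 : NNReal)⁻¹ * dvrAbs a := by
  by_cases ha : a = 0
  · simp [ha]
  rw [dvrAbs_of_ne_zero ha, dvrAbs_of_ne_zero (mul_ne_zero hϖ.ne_zero ha),
    IsDiscreteValuationRing.addVal_mul, IsDiscreteValuationRing.addVal_uniformizer hϖ,
    ENat.toNat_add (by simp) (IsDiscreteValuationRing.addVal_eq_top_iff.not.2 ha), ENat.toNat_one, pow_add, pow_one]

theorem dvrAbs_eq_one_of_isUnit {a : 𝔬} (ha : IsUnit a) : dvrAbs a = 1 := by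
  rw [dvrAbs_of_ne_zero ha.ne_zero, IsDiscreteValuationRing.addVal_eq_zero_iff.2 ha]
  simp

theorem dvrAbs_eq_one_of_residue_ne_zero {a : 𝔬} (ha : residue 𝔬 a ≠ 0) : dvrAbs a = 1 :=
  dvrAbs_eq_one_of_isUnit (by rwa [← notMem_maximalIdeal, ← residue_eq_zero_iff])

variable [Finite (ResidueField 𝔬)]

variable (𝔬) in
theorem one_lt_residueCard : 1 < residueCard 𝔬 := Finite.one_lt_card

variable (𝔬) in
theorem residueCard_inv_lt_one : (residueCard 𝔬 : NNReal)⁻¹ < 1 := by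
  apply inv_lt_one_of_one_lt₀
  exact_mod_cast one_lt_residueCard 𝔬

theorem dvrAbs_le_one (a : 𝔬) : dvrAbs a ≤ 1 := by
  rw [dvrAbs]
  split_ifs
  · exact zero_le_one
  · exact pow_le_one₀ zero_le (residueCard_inv_lt_one 𝔬).le

theorem dvrAbs_le_of_dvd {a b : 𝔬} (h : a ∣ b) : dvrAbs b ≤ dvrAbs a := by
  by_cases hb : b = 0
  · simp [hb]
  have ha : a ≠ 0 := fun h0 => hb (by rwa [h0, zero_dvd_iff] at h)
  rw [dvrAbs_of_ne_zero ha, dvrAbs_of_ne_zero hb]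
  refine pow_le_pow_of_le_one zero_le (residueCard_inv_lt_one 𝔬).le ?_
  exact ENat.toNat_le_toNat (IsDiscreteValuationRing.addVal_le_iff_dvd.2 h)
    (IsDiscreteValuationRing.addVal_eq_top_iff.not.2 hb)

theorem dvrAbs_add_le (a b : 𝔬) : dvrAbs (a + b) ≤ max (dvrAbs a) (dvrAbs b) := by
  rcases le_total (IsDiscreteValuationRing.addVal 𝔬 a) (IsDiscreteValuationRing.addVal 𝔬 b) with
    h | h <;> rw [IsDiscreteValuationRing.addVal_le_iff_dvd] at h
  · exact (dvrAbs_le_of_dvd ((dvd_refl a).add h)).trans (le_max_left _ _)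
  · exact (dvrAbs_le_of_dvd (h.add (dvd_refl b))).trans (le_max_right _ _)

omit [Finite (ResidueField 𝔬)] in
theorem dvrAbs_uniformizer_pow {ϖ : 𝔬} (hϖ : Irreducible ϖ) (n : ℕ) :
    dvrAbs (ϖ ^ n) = (residueCard 𝔬 : NNReal)⁻¹ ^ n := by
  induction n with
  | zero => simpa using dvrAbs_eq_one_of_isUnit (isUnit_one (M := 𝔬))
  | succ n ih => rw [pow_succ', dvrAbs_uniformizer_mul hϖ, ih, pow_succ']

theorem measurable_dvrAbs [TopologicalSpace 𝔬] [IsTopologicalRing 𝔬] [MeasurableSpace 𝔬]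
    [BorelSpace 𝔬] (h : IsAdic (maximalIdeal 𝔬)) : Measurable (dvrAbs : 𝔬 → NNReal) := by
  obtain ⟨ϖ, hϖ⟩ := IsDiscreteValuationRing.exists_irreducible 𝔬
  refine measurable_of_Iio fun r => IsOpen.measurableSet ?_
  rw [isOpen_iff_mem_nhds]
  intro a ha
  have hr : 0 < r := zero_le.trans_lt ha
  obtain ⟨n, hn⟩ := exists_pow_lt_of_lt_one hr (residueCard_inv_lt_one 𝔬)
  have h1 : (fun b => b - a) ⁻¹' ((maximalIdeal 𝔬 ^ n : Ideal 𝔬) : Set 𝔬) ∈ nhds a :=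
    (((isAdic_iff.1 h).1 n).preimage (continuous_id.sub continuous_const)).mem_nhds (by simp)
  filter_upwards [h1] with b hb
  have h2 : ϖ ^ n ∣ b - a := by
    rw [← Ideal.mem_span_singleton, ← Ideal.span_singleton_pow, ← hϖ.maximalIdeal_eq]
    exact hb
  have h3 := dvrAbs_add_le a (b - a)
  rw [add_sub_cancel] at h3
  refine h3.trans_lt (max_lt ha ((dvrAbs_le_of_dvd h2).trans_lt ?_))
  rwa [dvrAbs_uniformizer_pow hϖ]

end AbsoluteValue

section ResidueClasses

variable {𝔬 : Type*} [CommRing 𝔬] [IsDomain 𝔬] [IsDiscreteValuationRing 𝔬] {d : ℕ}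

/-- The residue class of the points that reduce to `p`. -/
def residueClass (p : Fin d → ResidueField 𝔬) : Set (Fin d → 𝔬) :=
  {z | ∀ j, residue 𝔬 (z j) = p j}

theorem iUnion_residueClass :
    ⋃ p : Fin d → ResidueField 𝔬, residueClass (𝔬 := 𝔬) p = Set.univ :=
  Set.iUnion_eq_univ_iff.2 fun z => ⟨fun j => residue 𝔬 (z j), fun _ => rfl⟩

theorem pairwise_disjoint_residueClass :
    Pairwise (Function.onFun Disjoint (residueClass (𝔬 := 𝔬) (d := d))) := by
  intro p p' hne
  rw [Function.onFun, Set.disjoint_left]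
  exact fun z hz hz' => hne (funext fun j => (hz j).symm.trans (hz' j))

theorem range_add_uniformizer_smul {ϖ : 𝔬} (hϖ : Irreducible ϖ) {p : Fin d → ResidueField 𝔬}
    {z₀ : Fin d → 𝔬} (hz₀ : z₀ ∈ residueClass p) :
    Set.range (fun w : Fin d → 𝔬 => z₀ + ϖ • w) = residueClass p := by
  have hres : residue 𝔬 ϖ = 0 := by
    rw [residue_eq_zero_iff, hϖ.maximalIdeal_eq]
    exact Ideal.mem_span_singleton_self ϖ
  ext z
  constructor
  · rintro ⟨w, rfl⟩ j
    simpa [hres] using hz₀ j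
  · intro hz
    have h : ∀ j, ∃ w, z j - z₀ j = ϖ * w := by
      intro j
      have : z j - z₀ j ∈ maximalIdeal 𝔬 := by
        rw [← residue_eq_zero_iff, map_sub, hz j, hz₀ j, sub_self]
      rwa [hϖ.maximalIdeal_eq, Ideal.mem_span_singleton] at this
    choose w hw using h
    exact ⟨w, funext fun j => by simp [← hw]⟩

end ResidueClasses

section Haar

variable {𝔬 : Type*} [CommRing 𝔬] [IsDomain 𝔬] [IsDiscreteValuationRing 𝔬]
  [TopologicalSpace 𝔬] [IsTopologicalRing 𝔬] [CompactSpace 𝔬] [MeasurableSpace 𝔬] [BorelSpace 𝔬]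
  {d : ℕ}

variable [SecondCountableTopology 𝔬] [T2Space 𝔬]

omit [IsDiscreteValuationRing 𝔬] in
theorem measurableEmbedding_add_uniformizer_smul {ϖ : 𝔬} (hϖ : Irreducible ϖ) (z₀ : Fin d → 𝔬) :
    MeasurableEmbedding (fun w : Fin d → 𝔬 => z₀ + ϖ • w) := by
  refine (Continuous.isClosedEmbedding (by fun_prop) ?_).measurableEmbedding
  intro w w' h
  funext j
  have := congrFun h j
  simpa [hϖ.ne_zero] using this

theorem measurableSet_residueClass (p : Fin d → ResidueField 𝔬) :
    MeasurableSet (residueClass p) := by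
  obtain ⟨ϖ, hϖ⟩ := IsDiscreteValuationRing.exists_irreducible 𝔬
  choose z hz using fun j => residue_surjective (R := 𝔬) (p j)
  rw [← range_add_uniformizer_smul hϖ (show z ∈ residueClass p from hz)]
  exact (measurableEmbedding_add_uniformizer_smul hϖ z).measurableSet_range

instance : (cubeHaar 𝔬 d).IsAddHaarMeasure :=
  inferInstanceAs (Measure.pi fun _ => Measure.addHaarMeasure _).IsAddHaarMeasure

instance : IsProbabilityMeasure (cubeHaar 𝔬 d) where
  measure_univ := by
    have : Measure.addHaarMeasure (⊤ : TopologicalSpace.PositiveCompacts 𝔬) Set.univ = 1 :=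
      Measure.addHaarMeasure_self
    simp [cubeHaar, Measure.pi_univ, this]

omit [T2Space 𝔬] in
theorem cubeHaar_residueClass_eq_zero (p : Fin d → ResidueField 𝔬) :
    cubeHaar 𝔬 d (residueClass p) = cubeHaar 𝔬 d (residueClass 0) := by
  choose z hz using fun j => residue_surjective (R := 𝔬) (p j)
  rw [← measure_preimage_add (cubeHaar 𝔬 d) z (residueClass p)]
  congr 1
  ext w
  simp [residueClass, hz]

variable [Finite (ResidueField 𝔬)]

theorem cubeHaar_residueClass (p : Fin d → ResidueField 𝔬) :
    cubeHaar 𝔬 d (residueClass p) = ((residueCard 𝔬 : ENNReal) ^ d)⁻¹ := by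
  have := Fintype.ofFinite (ResidueField 𝔬)
  have h1 : cubeHaar 𝔬 d (⋃ p, residueClass p) = ∑ p, cubeHaar 𝔬 d (residueClass p) := by
    rw [measure_iUnion pairwise_disjoint_residueClass measurableSet_residueClass, tsum_fintype]
  rw [iUnion_residueClass, measure_univ, Finset.sum_congr rfl fun p _ => cubeHaar_residueClass_eq_zero p,
    Finset.sum_const, Finset.card_univ, Fintype.card_fun, Fintype.card_fin, nsmul_eq_mul] at h1
  rw [cubeHaar_residueClass_eq_zero]
  refine ENNReal.eq_inv_of_mul_eq_one_left ?_
  rw [h1, residueCard, Nat.card_eq_fintype_card, mul_comm]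
  push_cast
  rfl

theorem comap_uniformizer_smul_cubeHaar {ϖ : 𝔬} (hϖ : Irreducible ϖ) :
    (cubeHaar 𝔬 d).comap (fun w => (0 : Fin d → 𝔬) + ϖ • w) =
      ((residueCard 𝔬 : ENNReal) ^ d)⁻¹ • cubeHaar 𝔬 d := by
  set ν := (cubeHaar 𝔬 d).comap (fun w => (0 : Fin d → 𝔬) + ϖ • w) with hν
  have hemb := measurableEmbedding_add_uniformizer_smul hϖ (0 : Fin d → 𝔬)
  have hinv : ν.IsAddLeftInvariant := by
    rw [← forall_measure_preimage_add_iff]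
    intro g s hs
    rw [hν, hemb.comap_apply, hemb.comap_apply]
    rw [← measure_preimage_add (cubeHaar 𝔬 d) (ϖ • g) (_ '' s)]
    congr 1
    ext z
    simp only [Set.mem_image, Set.mem_preimage, zero_add]
    constructor
    · rintro ⟨w, hw, rfl⟩
      exact ⟨g + w, hw, smul_add _ _ _⟩
    · rintro ⟨w, hw, h⟩
      refine ⟨w - g, by simpa using hw, ?_⟩
      rw [smul_sub, h]; simp
  have huniv : ν Set.univ = ((residueCard 𝔬 : ENNReal) ^ d)⁻¹ := by
    rw [hν, hemb.comap_apply, Set.image_univ, range_add_uniformizer_smul hϖ (p := 0)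
      (fun j => by simp), cubeHaar_residueClass]
  have hfin : IsFiniteMeasure ν := ⟨by
    rw [hν, hemb.comap_apply]; exact measure_lt_top _ _⟩
  have h := Measure.isAddInvariant_eq_smul_of_compactSpace ν (cubeHaar 𝔬 d)
  have h' := congrArg (fun m => m Set.univ) h
  simp only [Measure.smul_apply, measure_univ, huniv, ENNReal.smul_def, smul_eq_mul,
    mul_one] at h'
  refine Measure.ext fun s _ => ?_
  have hs := congrArg (fun m => m s) h
  simp only [Measure.smul_apply, ENNReal.smul_def, smul_eq_mul] at hs
  rw [hs, ← h', Measure.smul_apply, smul_eq_mul]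

theorem restrict_residueClass {ϖ : 𝔬} (hϖ : Irreducible ϖ) {p : Fin d → ResidueField 𝔬}
    {z₀ : Fin d → 𝔬} (hz₀ : z₀ ∈ residueClass p) :
    (cubeHaar 𝔬 d).restrict (residueClass p) =
      ((residueCard 𝔬 : ENNReal) ^ d)⁻¹ • (cubeHaar 𝔬 d).map fun w => z₀ + ϖ • w := by
  have hemb := measurableEmbedding_add_uniformizer_smul hϖ (0 : Fin d → 𝔬)
  have hemb' := measurableEmbedding_add_uniformizer_smul hϖ z₀
  have h1 : (cubeHaar 𝔬 d).comap (fun w => z₀ + ϖ • w) =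
      (cubeHaar 𝔬 d).comap (fun w => (0 : Fin d → 𝔬) + ϖ • w) := by
    ext s hs
    rw [hemb.comap_apply, hemb'.comap_apply,
      ← measure_preimage_add (cubeHaar 𝔬 d) (z₀) ((fun w => z₀ + ϖ • w) '' s)]
    congr 1
    ext z
    simp
  rw [← range_add_uniformizer_smul hϖ hz₀, ← hemb'.map_comap, h1,
    comap_uniformizer_smul_cubeHaar hϖ, Measure.map_smul]

end Haar

section ClassIntegrals

variable {𝔬 : Type*} [CommRing 𝔬] [IsDomain 𝔬] [IsDiscreteValuationRing 𝔬]
  [TopologicalSpace 𝔬] [IsTopologicalRing 𝔬] [CompactSpace 𝔬] [MeasurableSpace 𝔬] [BorelSpace 𝔬]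
  [SecondCountableTopology 𝔬] [T2Space 𝔬] [Finite (ResidueField 𝔬)] {d : ℕ}

theorem setLIntegral_residueClass_of_scaling {ϖ : 𝔬} (hϖ : Irreducible ϖ)
    {p : Fin d → ResidueField 𝔬} {z₀ : Fin d → 𝔬} (hz₀ : z₀ ∈ residueClass p)
    {f g : (Fin d → 𝔬) → ENNReal} {c : ENNReal} (hc : c ≠ ⊤)
    (h : ∀ w, f (z₀ + ϖ • w) = c * g (z₀ + w)) :
    ∫⁻ z in residueClass p, f z ∂cubeHaar 𝔬 d =
      ((residueCard 𝔬 : ENNReal) ^ d)⁻¹ * c * ∫⁻ z, g z ∂cubeHaar 𝔬 d := by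
  rw [restrict_residueClass hϖ hz₀, lintegral_smul_measure,
    (measurableEmbedding_add_uniformizer_smul hϖ z₀).lintegral_map]
  simp_rw [h]
  rw [lintegral_const_mul' _ _ hc, lintegral_add_left_eq_self, smul_eq_mul, mul_assoc]

theorem setIntegral_residueClass_of_scaling {ϖ : 𝔬} (hϖ : Irreducible ϖ)
    {p : Fin d → ResidueField 𝔬} {z₀ : Fin d → 𝔬} (hz₀ : z₀ ∈ residueClass p)
    {f g : (Fin d → 𝔬) → ℂ} {c : ℂ} (h : ∀ w, f (z₀ + ϖ • w) = c * g (z₀ + w)) :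
    ∫ z in residueClass p, f z ∂cubeHaar 𝔬 d =
      ((residueCard 𝔬 : ℂ) ^ d)⁻¹ * c * ∫ z, g z ∂cubeHaar 𝔬 d := by
  rw [restrict_residueClass hϖ hz₀, integral_smul_measure,
    (measurableEmbedding_add_uniformizer_smul hϖ z₀).integral_map]
  simp_rw [h]
  rw [integral_const_mul, integral_add_left_eq_self, Complex.real_smul, mul_assoc]
  congr 1
  simp

theorem integrableOn_residueClass_of_scaling {ϖ : 𝔬} (hϖ : Irreducible ϖ)
    {p : Fin d → ResidueField 𝔬} {z₀ : Fin d → 𝔬} (hz₀ : z₀ ∈ residueClass p)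
    {f g : (Fin d → 𝔬) → ℂ} {c : ℂ} (h : ∀ w, f (z₀ + ϖ • w) = c * g (z₀ + w))
    (hg : Integrable g (cubeHaar 𝔬 d)) : IntegrableOn f (residueClass p) (cubeHaar 𝔬 d) := by
  rw [IntegrableOn, restrict_residueClass hϖ hz₀]
  refine Integrable.smul_measure ?_ (by simp [(zero_lt_one.trans (one_lt_residueCard 𝔬)).ne'])
  rw [(measurableEmbedding_add_uniformizer_smul hϖ z₀).integrable_map_iff]
  have : f ∘ (fun w => z₀ + ϖ • w) = fun w => c * g (z₀ + w) := funext h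
  rw [this]
  exact (hg.comp_add_left z₀).const_mul c

theorem lintegral_eq_sum_residueClass [Fintype (ResidueField 𝔬)] (f : (Fin d → 𝔬) → ENNReal) :
    ∫⁻ z, f z ∂cubeHaar 𝔬 d = ∑ p, ∫⁻ z in residueClass p, f z ∂cubeHaar 𝔬 d := by
  rw [← setLIntegral_univ, ← iUnion_residueClass,
    lintegral_iUnion measurableSet_residueClass pairwise_disjoint_residueClass, tsum_fintype]

theorem integral_eq_sum_residueClass [Fintype (ResidueField 𝔬)] {f : (Fin d → 𝔬) → ℂ}
    (hf : Integrable f (cubeHaar 𝔬 d)) :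
    ∫ z, f z ∂cubeHaar 𝔬 d = ∑ p, ∫ z in residueClass p, f z ∂cubeHaar 𝔬 d := by
  rw [← setIntegral_univ, ← iUnion_residueClass,
    integral_iUnion measurableSet_residueClass pairwise_disjoint_residueClass hf.integrableOn,
    tsum_fintype]

omit [SecondCountableTopology 𝔬] [T2Space 𝔬] in
theorem integrable_of_residueClass {f : (Fin d → 𝔬) → ℂ}
    (hf : ∀ p, IntegrableOn f (residueClass p) (cubeHaar 𝔬 d)) :
    Integrable f (cubeHaar 𝔬 d) := by
  rw [← integrableOn_univ, ← iUnion_residueClass, integrableOn_finite_iUnion]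
  exact hf

end ClassIntegrals

theorem cpow_finsetSum {J : Type*} {x : ℂ} (hx : x ≠ 0) (t : Finset J) (f : J → ℂ) :
    x ^ ∑ j ∈ t, f j = ∏ j ∈ t, x ^ f j := by
  simp_rw [Complex.cpow_def_of_ne_zero hx, Finset.mul_sum, Complex.exp_sum]

namespace AffineForm

section Integrand

variable {R : Type*} [CommRing R] {d : ℕ} {ι : Type*} [Fintype ι]
  {K : Type*} [Field K] [Algebra R K] {L : ι → AffineForm R d}
  {𝔬 : Type*} [CommRing 𝔬] [IsDomain 𝔬] [IsDiscreteValuationRing 𝔬] [Algebra R 𝔬]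

theorem normSub_eq (x : AffineSubspace K (Fin d → K)) (z : Fin d → 𝔬) :
    normSub K L x z = (support L x).sup fun i => dvrAbs ((L i).eval z) := rfl

open Classical in
/-- The part of the integrand that comes from the flats whose hyperplanes have indices in `T`. -/
def localIntegrand (s : (arrangement K L).Nonbot → ℂ) (T : Finset ι) (z : Fin d → 𝔬) : ℂ :=
  ∏ v : (arrangement K L).Nonbot with support L v.1.1 ⊆ T,
    (((normSub K L v.1.1 z : NNReal) : ℝ) : ℂ) ^ s v

theorem localIntegrand_univ (s : (arrangement K L).Nonbot → ℂ) :
    (localIntegrand s Finset.univ : (Fin d → 𝔬) → ℂ) = zetaIntegrand K L s := by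
  classical
  funext z
  simp [localIntegrand, zetaIntegrand]

theorem normSub_add_smul {T : Finset ι} {z₀ : Fin d → 𝔬} (hz₀ : ∀ i ∈ T, (L i).eval z₀ = 0)
    {ϖ : 𝔬} (hϖ : Irreducible ϖ) {x : AffineSubspace K (Fin d → K)} (hx : support L x ⊆ T)
    (w : Fin d → 𝔬) :
    normSub K L x (z₀ + ϖ • w) = (residueCard 𝔬 : NNReal)⁻¹ * normSub K L x (z₀ + w) := by
  rw [normSub_eq, normSub_eq, NNReal.mul_finset_sup]
  refine Finset.sup_congr rfl fun i hi => ?_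
  have h1 := eval_add_smul (L i) z₀ w ϖ
  have h2 := eval_add_smul (L i) z₀ w 1
  rw [hz₀ i (hx hi), zero_add] at h1 h2
  rw [one_smul, one_mul] at h2
  rw [h1, h2, dvrAbs_uniformizer_mul hϖ]

open Classical in
theorem localIntegrand_add_smul (s : (arrangement K L).Nonbot → ℂ) {T : Finset ι}
    {z₀ : Fin d → 𝔬} (hz₀ : ∀ i ∈ T, (L i).eval z₀ = 0) {ϖ : 𝔬} (hϖ : Irreducible ϖ)
    (hq : residueCard 𝔬 ≠ 0) (w : Fin d → 𝔬) :
    localIntegrand s T (z₀ + ϖ • w) = (residueCard 𝔬 : ℂ) ^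
      (-∑ v : (arrangement K L).Nonbot with support L v.1.1 ⊆ T, s v) *
        localIntegrand s T (z₀ + w) := by
  have hq' : (residueCard 𝔬 : ℂ) ≠ 0 := by exact_mod_cast hq
  rw [localIntegrand, localIntegrand, ← Finset.sum_neg_distrib, cpow_finsetSum hq',
    ← Finset.prod_mul_distrib]
  refine Finset.prod_congr rfl fun v hv => ?_
  rw [normSub_add_smul hz₀ hϖ (Finset.mem_filter.1 hv).2, NNReal.coe_mul, Complex.ofReal_mul,
    Complex.mul_cpow_ofReal_nonneg (NNReal.coe_nonneg _) (NNReal.coe_nonneg _)]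
  congr 1
  rw [Complex.cpow_neg, ← Complex.inv_cpow]
  · simp
  · rw [Complex.natCast_arg]; exact Real.pi_ne_zero.symm

variable [Finite (ResidueField 𝔬)]

theorem normSub_le_one (x : AffineSubspace K (Fin d → K)) (z : Fin d → 𝔬) :
    normSub K L x z ≤ 1 := Finset.sup_le fun _ _ => dvrAbs_le_one _

theorem normSub_eq_one {x : AffineSubspace K (Fin d → K)} {p : Fin d → ResidueField 𝔬}
    {z : Fin d → 𝔬} (hz : z ∈ residueClass p) {i : ι} (hi : i ∈ support L x)
    (hp : (L i).eval p ≠ 0) : normSub K L x z = 1 := by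
  refine le_antisymm (normSub_le_one x z) ?_
  have : dvrAbs ((L i).eval z) = 1 := by
    refine dvrAbs_eq_one_of_residue_ne_zero ?_
    rw [residue_eval, show (fun j => residue 𝔬 (z j)) = p from funext hz]
    exact hp
  rw [← this, normSub_eq]
  exact Finset.le_sup (f := fun i => dvrAbs ((L i).eval z)) hi

theorem localIntegrand_congr (s : (arrangement K L).Nonbot → ℂ) {T T' : Finset ι} (hT : T' ⊆ T)
    {p : Fin d → ResidueField 𝔬} (hp : ∀ i ∈ T, (L i).eval p = 0 → i ∈ T')
    {z : Fin d → 𝔬} (hz : z ∈ residueClass p) :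
    localIntegrand s T z = localIntegrand s T' z := by
  classical
  symm
  refine Finset.prod_subset (fun v hv => ?_) fun v hv hv' => ?_
  · simp only [Finset.mem_filter, Finset.mem_univ, true_and] at hv ⊢
    exact hv.trans hT
  · simp only [Finset.mem_filter, Finset.mem_univ, true_and] at hv hv'
    obtain ⟨i, hi, hi'⟩ := Finset.not_subset.1 hv'
    rw [normSub_eq_one hz hi fun h => hi' (hp i (hv hi) h)]
    simp

variable [TopologicalSpace 𝔬] [IsTopologicalRing 𝔬] [MeasurableSpace 𝔬] [BorelSpace 𝔬]
  [SecondCountableTopology 𝔬]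

theorem measurable_normSub (hadic : IsAdic (maximalIdeal 𝔬)) (x : AffineSubspace K (Fin d → K)) :
    Measurable (normSub K L x : (Fin d → 𝔬) → NNReal) := by
  classical
  unfold normSub
  generalize (Finset.univ.filter fun i => x ≤ (L i).zeroLocus K) = T
  induction T using Finset.induction_on with
  | empty => simp
  | insert i T _ ih =>
    simp only [Finset.sup_insert]
    refine Measurable.max ((measurable_dvrAbs hadic).comp ?_) ih
    unfold eval
    fun_prop

theorem measurable_localIntegrand (hadic : IsAdic (maximalIdeal 𝔬))
    (s : (arrangement K L).Nonbot → ℂ) (T : Finset ι) :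
    Measurable (localIntegrand s T : (Fin d → 𝔬) → ℂ) := by
  classical
  unfold localIntegrand
  refine Finset.measurable_fun_prod _ fun v _ => ?_
  exact (Complex.measurable_ofReal.comp
    (measurable_coe_nnreal_real.comp (measurable_normSub hadic _))).pow_const _

end Integrand

section PointCounts

variable {R : Type*} [CommRing R] {d : ℕ} {ι : Type*} [Fintype ι]
  {K : Type*} [Field K] [Algebra R K] {k : Type*} [Field k] [Algebra R k] {L : ι → AffineForm R d}

/-- The point `p` over `k` kills exactly those forms with index in `T` that vanish on `y`. -/
def IsGenericOn (L : ι → AffineForm R d) (T : Finset ι) (p : Fin d → k)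
    (y : (arrangement K L).IntPoset) : Prop :=
  support L y.1 ⊆ T ∧ ∀ i ∈ T, (L i).eval p = 0 ↔ i ∈ support L y.1

theorem IsGenericOn.unique (hn : ∀ i, (L i).IsNonconstant K) {T : Finset ι} {p : Fin d → k}
    {y z : (arrangement K L).IntPoset} (hy : IsGenericOn L T p y) (hz : IsGenericOn L T p z) :
    y = z := by
  refine le_antisymm ((support_subset_iff hn y z).1 fun i hi => ?_)
    ((support_subset_iff hn z y).1 fun i hi => ?_)
  · exact (hz.2 i (hy.1 hi)).1 ((hy.2 i (hy.1 hi)).2 hi)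
  · exact (hy.2 i (hz.1 hi)).1 ((hz.2 i (hz.1 hi)).2 hi)

/-- The intersection with `T` of the support of a flat is the support of a flat. -/
def IsClosedIndexSet (K : Type*) [Field K] [Algebra R K] (L : ι → AffineForm R d)
    (T : Finset ι) : Prop :=
  ∀ u : (arrangement K L).IntPoset, ∃ y : (arrangement K L).IntPoset, ∀ i,
    i ∈ support L y.1 ↔ i ∈ support L u.1 ∧ i ∈ T

theorem isClosedIndexSet_univ : IsClosedIndexSet K L Finset.univ := fun u => ⟨u, by simp⟩

theorem isClosedIndexSet_support (hn : ∀ i, (L i).IsNonconstant K)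
    (x : (arrangement K L).IntPoset) : IsClosedIndexSet K L (support L x.1) :=
  fun u => exists_support_eq_inter hn u x

variable [IsDedekindDomain R] [IsFractionRing R K]

theorem exists_isGenericOn (hn : ∀ i, (L i).IsNonconstant K)
    (hinj : Function.Injective fun i => (L i).zeroLocus K)
    (e : (arrangement K L).IntPoset ≃o (arrangement k L).IntPoset) {T : Finset ι}
    (hT : IsClosedIndexSet K L T) (p : Fin d → k) :
    ∃ y : (arrangement K L).IntPoset, IsGenericOn L T p y := by
  obtain ⟨u, hu⟩ := exists_flat_of_residue_point hn hinj e p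
  obtain ⟨y, hy⟩ := hT u
  refine ⟨y, fun i hi => ((hy i).1 hi).2, fun i hi => ?_⟩
  rw [hu, hy]
  exact ⟨fun h => ⟨h, hi⟩, fun h => h.1⟩

variable [Fintype k]

open Classical in
/-- The number of the points over `k` that are generic on `y` relative to `T`. -/
def pointCount (k : Type*) [Field k] [Algebra R k] [Fintype k] (L : ι → AffineForm R d)
    (T : Finset ι) (y : (arrangement K L).IntPoset) : ℕ :=
  (Finset.univ.filter fun p : Fin d → k => IsGenericOn L T p y).card

open Classical in
theorem sum_isGenericOn (hn : ∀ i, (L i).IsNonconstant K)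
    (hinj : Function.Injective fun i => (L i).zeroLocus K)
    (e : (arrangement K L).IntPoset ≃o (arrangement k L).IntPoset) {T : Finset ι}
    (hT : IsClosedIndexSet K L T) {f : (Fin d → k) → ℂ} {g : (arrangement K L).IntPoset → ℂ}
    (h : ∀ p y, IsGenericOn L T p y → f p = g y) :
    ∑ p, f p = ∑ y : (arrangement K L).IntPoset, pointCount k L T y * g y := by
  have h1 : ∀ p : Fin d → k, f p =
      ∑ y : (arrangement K L).IntPoset, if IsGenericOn L T p y then g y else 0 := by
    intro p
    obtain ⟨y, hy⟩ := exists_isGenericOn hn hinj e hT p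
    rw [Finset.sum_eq_single y, if_pos hy, h p y hy]
    · exact fun z _ hz => if_neg fun hz' => hz (hz'.unique hn hy)
    · simp
  rw [Finset.sum_congr rfl fun p _ => h1 p, Finset.sum_comm]
  refine Finset.sum_congr rfl fun y _ => ?_
  rw [← Finset.sum_filter, Finset.sum_const, nsmul_eq_mul, pointCount]

omit [IsDedekindDomain R] [IsFractionRing R K] in
theorem pointCount_eq_zero {T : Finset ι} {y : (arrangement K L).IntPoset}
    (h : ¬ support L y.1 ⊆ T) : pointCount k L T y = 0 := by
  classical
  rw [pointCount, Finset.card_eq_zero, Finset.filter_eq_empty_iff]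
  exact fun p _ hp => h hp.1

open Classical in
theorem card_killing_points (hn : ∀ i, (L i).IsNonconstant K)
    (hinj : Function.Injective fun i => (L i).zeroLocus K)
    (e : (arrangement K L).IntPoset ≃o (arrangement k L).IntPoset)
    (x : (arrangement K L).IntPoset) :
    (Finset.univ.filter fun p : Fin d → k => ∀ i ∈ support L x.1, (L i).eval p = 0).card *
      Nat.card k ^ (arrangement K L).codim x = Nat.card k ^ d := by
  rw [← natCard_zeroSet_support hn hinj e x]
  congr 1
  rw [Nat.card_eq_fintype_card (α := {p : Fin d → k // _}), Fintype.card_subtype]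

open Classical in
theorem sum_pointCount (hn : ∀ i, (L i).IsNonconstant K)
    (hinj : Function.Injective fun i => (L i).zeroLocus K)
    (e : (arrangement K L).IntPoset ≃o (arrangement k L).IntPoset) {T : Finset ι}
    (hT : IsClosedIndexSet K L T) {w : (arrangement K L).IntPoset} (hw : support L w.1 ⊆ T) :
    ∑ y : (arrangement K L).IntPoset with w ≤ y, pointCount k L T y =
      (Finset.univ.filter fun p : Fin d → k => ∀ i ∈ support L w.1, (L i).eval p = 0).card := by
  have h := sum_isGenericOn hn hinj e hT
    (f := fun p => if ∀ i ∈ support L w.1, (L i).eval p = 0 then 1 else 0)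
    (g := fun y => if w ≤ y then 1 else 0) (fun p y hpy => by
      congr 1
      rw [eq_iff_iff, ← support_subset_iff hn]
      exact ⟨fun h i hi => (hpy.2 i (hw hi)).1 (h i hi),
        fun h i hi => (hpy.2 i (hw hi)).2 (h hi)⟩)
  simp only [mul_ite, mul_one, mul_zero] at h
  rw [← Finset.sum_filter, Finset.sum_const, ← Finset.sum_filter] at h
  have h' := h.symm
  rw [nsmul_eq_mul, mul_one] at h'
  exact_mod_cast h'

/-- The point counts are the values of the Poincaré polynomials of the intervals. -/
theorem aeval_poincare_eq_pointCount (hn : ∀ i, (L i).IsNonconstant K)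
    (hinj : Function.Injective fun i => (L i).zeroLocus K)
    (e : (arrangement K L).IntPoset ≃o (arrangement k L).IntPoset) {T : Finset ι}
    (hT : IsClosedIndexSet K L T) {x : (arrangement K L).IntPoset}
    (B : Arrangement K (Fin d → K)) (hB : B.ambient = x.1)
    (hflat : ∀ w : AffineSubspace K (Fin d → K), B.IsFlat w ↔
      (arrangement K L).IsFlat w ∧ w ≤ x.1 ∧ support L w ⊆ T) :
    Polynomial.aeval (-(Nat.card k : ℂ)⁻¹) B.poincare =
      pointCount k L T x * (Nat.card k : ℂ) ^ (arrangement K L).codim x *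
        ((Nat.card k : ℂ) ^ d)⁻¹ := by
  classical
  have hq : (Nat.card k : ℂ) ≠ 0 := by exact_mod_cast Nat.card_pos.ne'
  let i : B.IntPoset → (arrangement K L).IntPoset := fun w => ⟨w.1, ((hflat _).1 w.2).1⟩
  have hbot : i ⊥ = x := Subtype.ext hB
  rw [Arrangement.aeval_poincare_of_sum B _ (fun w => pointCount k L T (i w) *
    (Nat.card k : ℂ) ^ (arrangement K L).codim x * ((Nat.card k : ℂ) ^ d)⁻¹), hbot]
  intro w
  have hw := (hflat _).1 w.2
  have hwx : x ≤ i w := hw.2.1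
  rw [← Finset.sum_mul, ← Finset.sum_mul]
  have h1 : ∑ y : B.IntPoset with w ≤ y, (pointCount k L T (i y) : ℂ) =
      ∑ y : (arrangement K L).IntPoset with i w ≤ y, (pointCount k L T y : ℂ) := by
    refine Finset.sum_of_injOn i (fun y _ z _ h => ?_) (fun y hy => ?_) (fun y hy hy' => ?_)
      fun y _ => rfl
    · exact Subtype.ext (congrArg Subtype.val h :)
    · exact Finset.mem_coe.2 (Finset.mem_filter.2 ⟨Finset.mem_univ _, (Finset.mem_filter.1 hy).2⟩)
    · rw [pointCount_eq_zero, Nat.cast_zero]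
      intro hyT
      have hwy : i w ≤ y := (Finset.mem_filter.1 hy).2
      have hyx : y.1 ≤ x.1 := hwx.trans hwy
      refine hy' ⟨⟨y.1, (hflat _).2 ⟨y.2, hyx, hyT⟩⟩, ?_, rfl⟩
      exact Finset.mem_coe.2 (Finset.mem_filter.2 ⟨Finset.mem_univ _, hwy⟩)
  have h2 := card_killing_points hn hinj e (i w)
  rw [← sum_pointCount hn hinj e hT (w := i w) hw.2.2] at h2
  rw [h1]
  have h3 : Arrangement.codim B w + (arrangement K L).codim x = (arrangement K L).codim (i w) := by
    have e1 := Arrangement.finrank_add_codim B w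
    have e2 := finrank_add_codim_arrangement x
    have e3 := finrank_add_codim_arrangement (i w)
    rw [hB] at e1
    have e4 : (i w).1 = w.1 := rfl
    rw [e4] at e3
    omega
  have h2' : (∑ y : (arrangement K L).IntPoset with i w ≤ y, (pointCount k L T y : ℂ)) *
      (Nat.card k : ℂ) ^ (arrangement K L).codim (i w) = (Nat.card k : ℂ) ^ d := by
    exact_mod_cast h2
  rw [← h2', ← h3, pow_add, mul_inv]
  have h4 : (∑ y : (arrangement K L).IntPoset with i w ≤ y, (pointCount k L T y : ℂ)) ≠ 0 := by
    intro h0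
    rw [h0, zero_mul] at h2'
    exact pow_ne_zero d hq h2'.symm
  rw [inv_pow]
  field_simp

end PointCounts

section Exponent

variable {R : Type*} [CommRing R] {d : ℕ} {ι : Type*} [Fintype ι]
  {K : Type*} [Field K] [Algebra R K] {L : ι → AffineForm R d}

open Classical in
/-- The sum of the exponents of the flats below `y`. -/
def exponentSum (s : (arrangement K L).Nonbot → ℂ) (y : (arrangement K L).IntPoset) : ℂ :=
  ∑ v : (arrangement K L).Nonbot with v.1 ≤ y, s v

theorem gFun_eq_exponentSum (s : (arrangement K L).Nonbot → ℂ) (x : (arrangement K L).Nonbot) :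
    (arrangement K L).gFun s x = (arrangement K L).codim x.1 + exponentSum s x.1 := by
  rw [Arrangement.gFun_eq]
  rfl

theorem exponentSum_bot (s : (arrangement K L).Nonbot → ℂ) : exponentSum s ⊥ = 0 := by
  classical
  refine Finset.sum_eq_zero fun v hv => ?_
  exact absurd (le_bot_iff.1 (Finset.mem_filter.1 hv).2) v.2

variable {𝔬 : Type*} [CommRing 𝔬] [IsDomain 𝔬] [IsDiscreteValuationRing 𝔬] [Algebra R 𝔬]

theorem localIntegrand_bot (hn : ∀ i, (L i).IsNonconstant K) (s : (arrangement K L).Nonbot → ℂ)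
    (z : Fin d → 𝔬) :
    localIntegrand s (support L (⊥ : (arrangement K L).IntPoset).1) z = 1 := by
  classical
  rw [localIntegrand, Finset.filter_false_of_mem, Finset.prod_empty]
  exact fun v _ h => v.2 (le_bot_iff.1 ((support_subset_iff hn v.1 ⊥).1 h))

variable (𝔬) [TopologicalSpace 𝔬] [IsTopologicalRing 𝔬] [CompactSpace 𝔬]
  [MeasurableSpace 𝔬] [BorelSpace 𝔬] in
/-- The zeta function of the localization at the flat `y`. -/
def flatZeta (s : (arrangement K L).Nonbot → ℂ) (y : (arrangement K L).IntPoset) : ℂ :=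
  ∫ z, localIntegrand s (support L y.1) z ∂cubeHaar 𝔬 d

end Exponent

section Recursion

variable {R : Type*} [CommRing R] [IsDedekindDomain R] {d : ℕ} {ι : Type*} [Fintype ι]
  {K : Type*} [Field K] [Algebra R K] [IsFractionRing R K] {L : ι → AffineForm R d}
  {𝔬 : Type*} [CommRing 𝔬] [IsDomain 𝔬] [IsDiscreteValuationRing 𝔬] [Algebra R 𝔬]

theorem exists_scaling_point [Finite (ResidueField 𝔬)] (hn : ∀ i, (L i).IsNonconstant K)
    (hinj : Function.Injective fun i => (L i).zeroLocus K)
    (e : (arrangement K L).IntPoset ≃o (arrangement (ResidueField 𝔬) L).IntPoset)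
    (s : (arrangement K L).Nonbot → ℂ) {T : Finset ι} {p : Fin d → ResidueField 𝔬}
    {y : (arrangement K L).IntPoset} (hp : IsGenericOn L T p y) {ϖ : 𝔬} (hϖ : Irreducible ϖ) :
    ∃ z₀ ∈ residueClass p, (∀ i ∈ support L y.1, (L i).eval z₀ = 0) ∧
      ∀ w, localIntegrand s T (z₀ + ϖ • w) = (residueCard 𝔬 : ℂ) ^ (-exponentSum s y) *
        localIntegrand s (support L y.1) (z₀ + w) := by
  classical
  obtain ⟨z₀, hz₀, hL⟩ := exists_lift_of_flat hn hinj e y (p := p)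
    fun i hi => (hp.2 i (hp.1 hi)).2 hi
  refine ⟨z₀, hz₀, hL, fun w => ?_⟩
  have hw : z₀ + ϖ • w ∈ residueClass p := by
    rw [← range_add_uniformizer_smul hϖ (show z₀ ∈ residueClass p from hz₀)]
    exact ⟨w, rfl⟩
  rw [localIntegrand_congr s hp.1 (fun i hi => (hp.2 i hi).1) hw,
    localIntegrand_add_smul s hL hϖ (zero_lt_one.trans (one_lt_residueCard 𝔬)).ne']
  congr 3
  refine Finset.sum_congr (Finset.filter_congr fun v _ => ?_) fun _ _ => rfl
  exact support_subset_iff hn v.1 y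

variable [TopologicalSpace 𝔬] [IsTopologicalRing 𝔬] [CompactSpace 𝔬] [MeasurableSpace 𝔬]
  [BorelSpace 𝔬] [SecondCountableTopology 𝔬] [T2Space 𝔬] [Fintype (ResidueField 𝔬)]

theorem integral_localIntegrand (hn : ∀ i, (L i).IsNonconstant K)
    (hinj : Function.Injective fun i => (L i).zeroLocus K)
    (e : (arrangement K L).IntPoset ≃o (arrangement (ResidueField 𝔬) L).IntPoset)
    (s : (arrangement K L).Nonbot → ℂ) {T : Finset ι} (hT : IsClosedIndexSet K L T)
    (hint : Integrable (localIntegrand s T) (cubeHaar 𝔬 d)) :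
    ∫ z, localIntegrand s T z ∂cubeHaar 𝔬 d = ∑ y : (arrangement K L).IntPoset,
      pointCount (ResidueField 𝔬) L T y * (((residueCard 𝔬 : ℂ) ^ d)⁻¹ *
        (residueCard 𝔬 : ℂ) ^ (-exponentSum s y) * flatZeta 𝔬 s y) := by
  obtain ⟨ϖ, hϖ⟩ := IsDiscreteValuationRing.exists_irreducible 𝔬
  rw [integral_eq_sum_residueClass hint]
  refine sum_isGenericOn hn hinj e hT fun p y hp => ?_
  obtain ⟨z₀, hz₀, -, h⟩ := exists_scaling_point hn hinj e s hp hϖ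
  exact setIntegral_residueClass_of_scaling hϖ hz₀ h

omit [Fintype (ResidueField 𝔬)] in
theorem integrableOn_residueClass_localIntegrand (hn : ∀ i, (L i).IsNonconstant K)
    (hinj : Function.Injective fun i => (L i).zeroLocus K)
    (e : (arrangement K L).IntPoset ≃o (arrangement (ResidueField 𝔬) L).IntPoset)
    (s : (arrangement K L).Nonbot → ℂ) {T : Finset ι} {p : Fin d → ResidueField 𝔬}
    {y : (arrangement K L).IntPoset} (hp : IsGenericOn L T p y)
    (hint : Integrable (localIntegrand s (support L y.1)) (cubeHaar 𝔬 d)) [Finite (ResidueField 𝔬)] :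
    IntegrableOn (localIntegrand s T) (residueClass p) (cubeHaar 𝔬 d) := by
  obtain ⟨ϖ, hϖ⟩ := IsDiscreteValuationRing.exists_irreducible 𝔬
  obtain ⟨z₀, hz₀, -, h⟩ := exists_scaling_point hn hinj e s hp hϖ
  exact integrableOn_residueClass_of_scaling hϖ hz₀ h hint

theorem ae_normSub_pos (hadic : IsAdic (maximalIdeal 𝔬)) (hn : ∀ i, (L i).IsNonconstant K)
    (hinj : Function.Injective fun i => (L i).zeroLocus K)
    (e : (arrangement K L).IntPoset ≃o (arrangement (ResidueField 𝔬) L).IntPoset)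
    {x : (arrangement K L).IntPoset} (hx : x ≠ ⊥) :
    ∀ᵐ z ∂cubeHaar 𝔬 d, 0 < normSub K L x.1 z := by
  classical
  obtain ⟨ϖ, hϖ⟩ := IsDiscreteValuationRing.exists_irreducible 𝔬
  have hq0 : (residueCard 𝔬 : ENNReal) ≠ 0 := by
    exact_mod_cast (zero_lt_one.trans (one_lt_residueCard 𝔬)).ne'
  have hqt : (residueCard 𝔬 : ENNReal) ≠ ⊤ := ENNReal.natCast_ne_top _
  set f : (Fin d → 𝔬) → ENNReal := fun z => if normSub K L x.1 z = 0 then 1 else 0 with hf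
  have hfm : Measurable f := Measurable.ite
    ((measurable_normSub hadic _) (measurableSet_singleton 0)) measurable_const measurable_const
  have hle : ∫⁻ z, f z ∂cubeHaar 𝔬 d ≤ 1 := by
    refine (lintegral_mono (g := fun _ => 1) fun z => ?_).trans (by simp)
    simp only [hf]
    split_ifs <;> simp
  have hclass : ∀ p : Fin d → ResidueField 𝔬, ∫⁻ z in residueClass p, f z ∂cubeHaar 𝔬 d =
      if ∀ i ∈ support L x.1, (L i).eval p = 0 then
        ((residueCard 𝔬 : ENNReal) ^ d)⁻¹ * ∫⁻ z, f z ∂cubeHaar 𝔬 d else 0 := by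
    intro p
    split_ifs with hp
    · obtain ⟨z₀, hz₀, hL⟩ := exists_lift_of_flat hn hinj e x hp
      rw [setLIntegral_residueClass_of_scaling hϖ hz₀ (g := f) ENNReal.one_ne_top, mul_one]
      intro w
      have := normSub_add_smul hL hϖ subset_rfl w
      simp only [hf, this, one_mul, mul_eq_zero, inv_eq_zero]
      have hq : (residueCard 𝔬 : NNReal) ≠ 0 := by
        exact_mod_cast (zero_lt_one.trans (one_lt_residueCard 𝔬)).ne'
      simp [hq]
    · push Not at hp
      obtain ⟨i, hi, hpi⟩ := hp
      rw [setLIntegral_congr_fun (measurableSet_residueClass p) (g := fun _ => 0)]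
      · simp
      · intro z hz
        simp [hf, normSub_eq_one hz hi hpi]
  have hsum := lintegral_eq_sum_residueClass f
  rw [Finset.sum_congr rfl fun p _ => hclass p, ← Finset.sum_filter, Finset.sum_const,
    nsmul_eq_mul, ← mul_assoc] at hsum
  have hcard := card_killing_points hn hinj e x
  set N := (Finset.univ.filter fun p : Fin d → ResidueField 𝔬 =>
    ∀ i ∈ support L x.1, (L i).eval p = 0).card with hN
  have hlt : (N : ENNReal) * ((residueCard 𝔬 : ENNReal) ^ d)⁻¹ < 1 := by
    rw [← div_eq_mul_inv, ENNReal.div_lt_iff (by simp [hq0]) (by simp [hqt]), one_mul]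
    have : N < Nat.card (ResidueField 𝔬) ^ d := by
      rw [← hcard]
      have hc : (arrangement K L).codim x ≠ 0 := by
        have := (arrangement K L).codim_strictMono (bot_lt_iff_ne_bot.2 hx)
        omega
      have hNpos : 0 < N := by
        rcases Nat.eq_zero_or_pos N with h0 | h0
        · rw [h0, zero_mul] at hcard
          exact absurd hcard.symm (pow_ne_zero _ Nat.card_pos.ne')
        · exact h0
      exact lt_mul_of_one_lt_right hNpos (one_lt_pow₀ (one_lt_residueCard 𝔬) hc)
    exact_mod_cast this
  have hzero : ∫⁻ z, f z ∂cubeHaar 𝔬 d = 0 := by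
    by_contra hne
    have h1 : (N : ENNReal) * ((residueCard 𝔬 : ENNReal) ^ d)⁻¹ * ∫⁻ z, f z ∂cubeHaar 𝔬 d <
        1 * ∫⁻ z, f z ∂cubeHaar 𝔬 d :=
      ENNReal.mul_lt_mul_left hne (hle.trans_lt ENNReal.one_lt_top).ne hlt
    rw [one_mul] at h1
    exact h1.ne hsum.symm
  rw [lintegral_eq_zero_iff hfm] at hzero
  filter_upwards [hzero] with z hz
  rw [pos_iff_ne_zero]
  intro h0
  simp [hf, h0] at hz

theorem integrable_localIntegrand_of_lt (hadic : IsAdic (maximalIdeal 𝔬))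
    (hn : ∀ i, (L i).IsNonconstant K)
    (hinj : Function.Injective fun i => (L i).zeroLocus K)
    (e : (arrangement K L).IntPoset ≃o (arrangement (ResidueField 𝔬) L).IntPoset)
    (s : (arrangement K L).Nonbot → ℂ) {x : (arrangement K L).IntPoset} (hx : x ≠ ⊥)
    (hre : 0 < ((arrangement K L).codim x + exponentSum s x).re)
    (hlt : ∀ y < x, Integrable (localIntegrand s (support L y.1)) (cubeHaar 𝔬 d)) :
    Integrable (localIntegrand s (support L x.1)) (cubeHaar 𝔬 d) := by
  classical
  obtain ⟨ϖ, hϖ⟩ := IsDiscreteValuationRing.exists_irreducible 𝔬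
  set f : (Fin d → 𝔬) → ENNReal := fun z => ‖localIntegrand s (support L x.1) z‖ₑ with hf
  have hfm : Measurable f := (measurable_localIntegrand hadic s _).enorm
  set U : ℕ → Set (Fin d → 𝔬) :=
    fun n => {z | (residueCard 𝔬 : NNReal)⁻¹ ^ n < normSub K L x.1 z} with hU
  have hUm : ∀ n, MeasurableSet (U n) := fun n =>
    measurableSet_lt measurable_const (measurable_normSub hadic _)
  set a : ℕ → ENNReal := fun n => ∫⁻ z, (U n).indicator f z ∂cubeHaar 𝔬 d with ha
  set c : ENNReal := ‖(residueCard 𝔬 : ℂ) ^ (-exponentSum s x)‖ₑ with hc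
  set Z := Finset.univ.filter fun p : Fin d → ResidueField 𝔬 =>
    ∀ i ∈ support L x.1, (L i).eval p = 0 with hZ
  set B : ENNReal := ∑ p ∈ Zᶜ, ∫⁻ z in residueClass p, f z ∂cubeHaar 𝔬 d with hB
  set t : ENNReal := Z.card * (((residueCard 𝔬 : ENNReal) ^ d)⁻¹ * c) with ht
  have hBtop : B < ⊤ := by
    refine ENNReal.sum_lt_top.2 fun p hp => ?_
    obtain ⟨y, hy⟩ := exists_isGenericOn hn hinj e (isClosedIndexSet_support hn x) p
    have hyx : y ≤ x := (support_subset_iff hn y x).1 hy.1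
    have hne : y ≠ x := by
      rintro rfl
      rw [Finset.mem_compl] at hp
      exact hp (Finset.mem_filter.2 ⟨Finset.mem_univ _, fun i hi => (hy.2 i hi).2 hi⟩)
    exact (integrableOn_residueClass_localIntegrand hn hinj e s hy
      (hlt y (lt_of_le_of_ne hyx hne))).hasFiniteIntegral
  have htlt : t < 1 := by
    have hq0 : (residueCard 𝔬 : ℂ) ≠ 0 := by
      exact_mod_cast (zero_lt_one.trans (one_lt_residueCard 𝔬)).ne'
    have hcard : (Z.card : ℂ) * (residueCard 𝔬 : ℂ) ^ (arrangement K L).codim x =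
        (residueCard 𝔬 : ℂ) ^ d := by
      exact_mod_cast card_killing_points hn hinj e x
    have h1 : (Z.card : ℂ) * (((residueCard 𝔬 : ℂ) ^ d)⁻¹ *
        (residueCard 𝔬 : ℂ) ^ (-exponentSum s x)) =
        (residueCard 𝔬 : ℂ) ^ (-((arrangement K L).codim x + exponentSum s x)) := by
      have hz : (Z.card : ℂ) ≠ 0 := fun h0 => by
        rw [h0, zero_mul] at hcard
        exact pow_ne_zero d hq0 hcard.symm
      rw [← hcard, neg_add, Complex.cpow_add _ _ hq0, Complex.cpow_neg _ (Nat.cast _),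
        Complex.cpow_natCast]
      field_simp
    have h2 : t = ‖(residueCard 𝔬 : ℂ) ^ (-((arrangement K L).codim x + exponentSum s x))‖ₑ := by
      have hnat : ∀ n : ℕ, ‖(n : ℂ)‖ₑ = n := fun n => by
        rw [← ofReal_norm, Complex.norm_natCast, ENNReal.ofReal_natCast]
      rw [← h1, enorm_mul, enorm_mul, enorm_inv (pow_ne_zero d hq0), enorm_pow, hnat, hnat]
    rw [h2, ← ofReal_norm, ENNReal.ofReal_lt_one,
      Complex.norm_natCast_cpow_of_pos (zero_lt_one.trans (one_lt_residueCard 𝔬))]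
    refine Real.rpow_lt_one_of_one_lt_of_neg (by exact_mod_cast one_lt_residueCard 𝔬) ?_
    rw [Complex.neg_re]
    linarith
  have ha0 : a 0 = 0 := by
    have : U 0 = ∅ := by
      ext z
      simpa [hU] using normSub_le_one x.1 z
    simp [ha, this]
  have hstep : ∀ n, a (n + 1) ≤ B + t * a n := by
    intro n
    have h1 : a (n + 1) = ∑ p ∈ Zᶜ, ∫⁻ z in residueClass p, (U (n + 1)).indicator f z ∂cubeHaar 𝔬 d +
        ∑ p ∈ Z, ∫⁻ z in residueClass p, (U (n + 1)).indicator f z ∂cubeHaar 𝔬 d := by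
      rw [Finset.sum_compl_add_sum]
      exact lintegral_eq_sum_residueClass _
    rw [h1]
    refine add_le_add (Finset.sum_le_sum fun p _ => lintegral_mono fun z =>
      Set.indicator_le_self _ _ _) (le_of_eq ?_)
    rw [ht, mul_assoc, ← nsmul_eq_mul, ← Finset.sum_const]
    refine Finset.sum_congr rfl fun p hp => ?_
    have hgen : IsGenericOn L (support L x.1) p x :=
      ⟨subset_rfl, fun i hi => ⟨fun _ => hi, fun hi => (Finset.mem_filter.1 hp).2 i hi⟩⟩
    obtain ⟨z₀, hz₀, hL, h⟩ := exists_scaling_point hn hinj e s hgen hϖ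
    refine setLIntegral_residueClass_of_scaling hϖ hz₀ (by simp [hc]) fun w => ?_
    have hmem : z₀ + ϖ • w ∈ U (n + 1) ↔ z₀ + w ∈ U n := by
      simp only [hU, Set.mem_ofPred_eq, normSub_add_smul hL hϖ subset_rfl w, pow_succ']
      refine mul_lt_mul_iff_right₀ (inv_pos.2 ?_)
      exact_mod_cast zero_lt_one.trans (one_lt_residueCard 𝔬)
    by_cases hw : z₀ + w ∈ U n
    · rw [Set.indicator_of_mem hw, Set.indicator_of_mem (hmem.2 hw)]
      simp only [hf]
      rw [h, enorm_mul]
    · rw [Set.indicator_of_notMem hw, Set.indicator_of_notMem (mt hmem.1 hw), mul_zero]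
  have hbound : ∀ n, a n ≤ B * (1 - t)⁻¹ := by
    intro n
    induction n with
    | zero => rw [ha0]; exact zero_le
    | succ n ih =>
      refine (hstep n).trans ((add_le_add le_rfl (mul_le_mul le_rfl ih zero_le zero_le)).trans ?_)
      have h1 : (1 - t) * (1 - t)⁻¹ = 1 :=
        ENNReal.mul_inv_cancel (tsub_pos_of_lt htlt).ne' (by simp)
      have h2 : 1 + t * (1 - t)⁻¹ = (1 - t)⁻¹ := by
        nth_rw 1 [← h1]
        rw [← add_mul, tsub_add_cancel_of_le htlt.le, one_mul]
      calc B + t * (B * (1 - t)⁻¹) = B * (1 + t * (1 - t)⁻¹) := by ring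
        _ ≤ B * (1 - t)⁻¹ := by rw [h2]
  refine ⟨(measurable_localIntegrand hadic s _).aestronglyMeasurable, ?_⟩
  have hmono : Monotone U := by
    intro m n hmn z hz
    exact (pow_le_pow_of_le_one zero_le (residueCard_inv_lt_one 𝔬).le hmn).trans_lt hz
  have hunion : ∀ᵐ z ∂cubeHaar 𝔬 d, z ∈ ⋃ n, U n := by
    filter_upwards [ae_normSub_pos hadic hn hinj e hx] with z hz
    obtain ⟨n, hn⟩ := exists_pow_lt_of_lt_one hz (residueCard_inv_lt_one 𝔬)
    exact Set.mem_iUnion.2 ⟨n, hn⟩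
  have hlim : ∫⁻ z, f z ∂cubeHaar 𝔬 d = ⨆ n, a n := by
    rw [← Measure.restrict_eq_self_of_ae_mem hunion,
      setLIntegral_iUnion_of_directed f hmono.directed_le]
    simp_rw [ha, lintegral_indicator (hUm _)]
  change ∫⁻ z, f z ∂cubeHaar 𝔬 d < ⊤
  rw [hlim]
  refine (iSup_le hbound).trans_lt (ENNReal.mul_lt_top hBtop ?_)
  exact ENNReal.inv_lt_top.2 (tsub_pos_of_lt htlt)

end Recursion

section PoincareValues

variable {R : Type*} [CommRing R] [IsDedekindDomain R] {d : ℕ} {ι : Type*} [Fintype ι]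
  {K : Type*} [Field K] [Algebra R K] [IsFractionRing R K] {L : ι → AffineForm R d}
  {𝔬 : Type*} [CommRing 𝔬] [IsDomain 𝔬] [IsDiscreteValuationRing 𝔬] [Algebra R 𝔬]
  [Fintype (ResidueField 𝔬)]

theorem aeval_poincare_restrict (hn : ∀ i, (L i).IsNonconstant K)
    (hinj : Function.Injective fun i => (L i).zeroLocus K)
    (e : (arrangement K L).IntPoset ≃o (arrangement (ResidueField 𝔬) L).IntPoset)
    (x : (arrangement K L).IntPoset) :
    Polynomial.aeval (-(residueCard 𝔬 : ℂ)⁻¹) ((arrangement K L).restrict x).poincare =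
      pointCount (ResidueField 𝔬) L Finset.univ x *
        (residueCard 𝔬 : ℂ) ^ (arrangement K L).codim x * ((residueCard 𝔬 : ℂ) ^ d)⁻¹ := by
  refine aeval_poincare_eq_pointCount hn hinj e isClosedIndexSet_univ _ rfl fun w => ?_
  rw [Arrangement.isFlat_restrict_iff]
  simp

theorem aeval_poincare_restrict_sub (hn : ∀ i, (L i).IsNonconstant K)
    (hinj : Function.Injective fun i => (L i).zeroLocus K)
    (e : (arrangement K L).IntPoset ≃o (arrangement (ResidueField 𝔬) L).IntPoset)
    {x y : (arrangement K L).IntPoset} (hxy : x ≤ y) :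
    Polynomial.aeval (-(residueCard 𝔬 : ℂ)⁻¹)
        (((arrangement K L).restrict x).sub y.1).poincare =
      pointCount (ResidueField 𝔬) L (support L y.1) x *
        (residueCard 𝔬 : ℂ) ^ (arrangement K L).codim x * ((residueCard 𝔬 : ℂ) ^ d)⁻¹ := by
  refine aeval_poincare_eq_pointCount hn hinj e (isClosedIndexSet_support hn y) _ rfl fun w => ?_
  rw [Arrangement.isFlat_restrict_sub_iff _ hxy]
  refine and_congr_right fun hw => and_congr_right fun _ => ?_
  exact (support_subset_iff hn ⟨w, hw⟩ y).symm

theorem pointCount_support_self (hn : ∀ i, (L i).IsNonconstant K)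
    (hinj : Function.Injective fun i => (L i).zeroLocus K)
    (e : (arrangement K L).IntPoset ≃o (arrangement (ResidueField 𝔬) L).IntPoset)
    (x : (arrangement K L).IntPoset) :
    (pointCount (ResidueField 𝔬) L (support L x.1) x : ℂ) *
        (residueCard 𝔬 : ℂ) ^ (arrangement K L).codim x * ((residueCard 𝔬 : ℂ) ^ d)⁻¹ = 1 := by
  classical
  have hq0 : (residueCard 𝔬 : ℂ) ≠ 0 := by
    exact_mod_cast (zero_lt_one.trans (one_lt_residueCard 𝔬)).ne'
  have h := card_killing_points hn hinj e x
  have h1 : pointCount (ResidueField 𝔬) L (support L x.1) x =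
      (Finset.univ.filter fun p : Fin d → ResidueField 𝔬 =>
        ∀ i ∈ support L x.1, (L i).eval p = 0).card := by
    unfold pointCount
    congr 1
    refine Finset.filter_congr fun p _ => ?_
    exact ⟨fun h i hi => (h.2 i hi).2 hi, fun h => ⟨subset_rfl, fun i hi =>
      ⟨fun _ => hi, fun _ => h i hi⟩⟩⟩
  rw [← h1] at h
  have h2 : (pointCount (ResidueField 𝔬) L (support L x.1) x : ℂ) *
      (residueCard 𝔬 : ℂ) ^ (arrangement K L).codim x = (residueCard 𝔬 : ℂ) ^ d := by
    exact_mod_cast h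
  rw [h2, mul_inv_cancel₀ (pow_ne_zero d hq0)]

end PoincareValues

section FlatWeights

variable {R : Type*} [CommRing R] {d : ℕ} {ι : Type*} [Fintype ι]
  {K : Type*} [Field K] [Algebra R K] {L : ι → AffineForm R d}
  {𝔬 : Type*} [CommRing 𝔬] [IsDomain 𝔬] [IsDiscreteValuationRing 𝔬]

theorem norm_cpow_neg_lt_one [Finite (ResidueField 𝔬)] {g : ℂ} (hg : 0 < g.re) : ‖(residueCard 𝔬 : ℂ) ^ (-g)‖ < 1 := by
  rw [Complex.norm_natCast_cpow_of_pos (zero_lt_one.trans (one_lt_residueCard 𝔬))]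
  refine Real.rpow_lt_one_of_one_lt_of_neg (by exact_mod_cast one_lt_residueCard 𝔬) ?_
  rw [Complex.neg_re]
  linarith

theorem cpow_neg_ne_one [Finite (ResidueField 𝔬)] {g : ℂ} (hg : 0 < g.re) : (residueCard 𝔬 : ℂ) ^ (-g) ≠ 1 := by
  intro h
  have := norm_cpow_neg_lt_one (𝔬 := 𝔬) hg
  rw [h, norm_one] at this
  exact this.ne rfl

variable [Algebra R 𝔬] [TopologicalSpace 𝔬] [IsTopologicalRing 𝔬] [CompactSpace 𝔬]
  [MeasurableSpace 𝔬] [BorelSpace 𝔬]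

variable (𝔬) in
/-- The weight `q^(-g_y(s)) ζ_y(s)` of the flat `y`. -/
def flatWeight (s : (arrangement K L).Nonbot → ℂ) (y : (arrangement K L).IntPoset) : ℂ :=
  (residueCard 𝔬 : ℂ) ^ (-((arrangement K L).codim y + exponentSum s y)) * flatZeta 𝔬 s y

theorem flatWeight_bot [SecondCountableTopology 𝔬] (hn : ∀ i, (L i).IsNonconstant K) (s : (arrangement K L).Nonbot → ℂ) :
    flatWeight 𝔬 s ⊥ = 1 := by
  rw [flatWeight, flatZeta, exponentSum_bot, Arrangement.codim_bot]
  simp [localIntegrand_bot hn s]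

theorem flatWeight_eq (s : (arrangement K L).Nonbot → ℂ) (x : (arrangement K L).Nonbot) :
    flatWeight 𝔬 s x.1 = (residueCard 𝔬 : ℂ) ^ (-(arrangement K L).gFun s x) *
      flatZeta 𝔬 s x.1 := by
  rw [flatWeight, gFun_eq_exponentSum]

end FlatWeights

section FlagFormula

variable {R : Type*} [CommRing R] [IsDedekindDomain R] {d : ℕ} {ι : Type*} [Fintype ι]
  {K : Type*} [Field K] [Algebra R K] [IsFractionRing R K] {L : ι → AffineForm R d}
  {𝔬 : Type*} [CommRing 𝔬] [IsDomain 𝔬] [IsDiscreteValuationRing 𝔬] [Algebra R 𝔬]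
  [TopologicalSpace 𝔬] [IsTopologicalRing 𝔬] [CompactSpace 𝔬] [MeasurableSpace 𝔬]
  [BorelSpace 𝔬] [SecondCountableTopology 𝔬] [T2Space 𝔬] [Fintype (ResidueField 𝔬)]

theorem integrable_localIntegrand_support (hadic : IsAdic (maximalIdeal 𝔬))
    (hn : ∀ i, (L i).IsNonconstant K)
    (hinj : Function.Injective fun i => (L i).zeroLocus K)
    (e : (arrangement K L).IntPoset ≃o (arrangement (ResidueField 𝔬) L).IntPoset)
    {s : (arrangement K L).Nonbot → ℂ} (hs : s ∈ (arrangement K L).convDomain)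
    (x : (arrangement K L).IntPoset) :
    Integrable (localIntegrand s (support L x.1)) (cubeHaar 𝔬 d) := by
  induction x using WellFoundedLT.induction with
  | ind x ih =>
    by_cases hx : x = ⊥
    · rw [hx]
      have : (localIntegrand s (support L (⊥ : (arrangement K L).IntPoset).1) :
          (Fin d → 𝔬) → ℂ) = fun _ => 1 := funext (localIntegrand_bot hn s)
      rw [this]
      exact integrable_const _
    · refine integrable_localIntegrand_of_lt hadic hn hinj e s hx ?_ ih
      rw [← gFun_eq_exponentSum s ⟨x, hx⟩]
      exact hs ⟨x, hx⟩

theorem integrable_localIntegrand (hadic : IsAdic (maximalIdeal 𝔬))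
    (hn : ∀ i, (L i).IsNonconstant K)
    (hinj : Function.Injective fun i => (L i).zeroLocus K)
    (e : (arrangement K L).IntPoset ≃o (arrangement (ResidueField 𝔬) L).IntPoset)
    {s : (arrangement K L).Nonbot → ℂ} (hs : s ∈ (arrangement K L).convDomain)
    {T : Finset ι} (hT : IsClosedIndexSet K L T) :
    Integrable (localIntegrand s T) (cubeHaar 𝔬 d) := by
  refine integrable_of_residueClass fun p => ?_
  obtain ⟨y, hy⟩ := exists_isGenericOn hn hinj e hT p
  exact integrableOn_residueClass_localIntegrand hn hinj e s hy
    (integrable_localIntegrand_support hadic hn hinj e hs y)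

theorem integral_localIntegrand_eq_sum (hadic : IsAdic (maximalIdeal 𝔬))
    (hn : ∀ i, (L i).IsNonconstant K)
    (hinj : Function.Injective fun i => (L i).zeroLocus K)
    (e : (arrangement K L).IntPoset ≃o (arrangement (ResidueField 𝔬) L).IntPoset)
    {s : (arrangement K L).Nonbot → ℂ} (hs : s ∈ (arrangement K L).convDomain)
    {T : Finset ι} (hT : IsClosedIndexSet K L T) :
    ∫ z, localIntegrand s T z ∂cubeHaar 𝔬 d = ∑ y : (arrangement K L).IntPoset,
      pointCount (ResidueField 𝔬) L T y *
        (residueCard 𝔬 : ℂ) ^ (arrangement K L).codim y * ((residueCard 𝔬 : ℂ) ^ d)⁻¹ *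
        flatWeight 𝔬 s y := by
  have hq0 : (residueCard 𝔬 : ℂ) ≠ 0 := by
    exact_mod_cast (zero_lt_one.trans (one_lt_residueCard 𝔬)).ne'
  rw [integral_localIntegrand hn hinj e s hT (integrable_localIntegrand hadic hn hinj e hs hT)]
  refine Finset.sum_congr rfl fun y _ => ?_
  rw [flatWeight, neg_add, Complex.cpow_add _ _ hq0, Complex.cpow_neg _ (Nat.cast _),
    Complex.cpow_natCast]
  have := pow_ne_zero ((arrangement K L).codim y) hq0
  field_simp

open Classical in
theorem flatZeta_eq (hadic : IsAdic (maximalIdeal 𝔬)) (hn : ∀ i, (L i).IsNonconstant K)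
    (hinj : Function.Injective fun i => (L i).zeroLocus K)
    (e : (arrangement K L).IntPoset ≃o (arrangement (ResidueField 𝔬) L).IntPoset)
    {s : (arrangement K L).Nonbot → ℂ} (hs : s ∈ (arrangement K L).convDomain)
    (x : (arrangement K L).IntPoset) :
    flatZeta 𝔬 s x = flatWeight 𝔬 s x + ∑ z : (arrangement K L).IntPoset with z < x,
      Polynomial.aeval (-(residueCard 𝔬 : ℂ)⁻¹)
        (((arrangement K L).restrict z).sub x.1).poincare * flatWeight 𝔬 s z := by
  rw [flatZeta, integral_localIntegrand_eq_sum hadic hn hinj e hs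
    (isClosedIndexSet_support hn x), ← Finset.add_sum_erase _ _ (Finset.mem_univ x),
    pointCount_support_self hn hinj e x, one_mul]
  congr 1
  symm
  refine Finset.sum_subset_zero_on_sdiff (fun z hz => ?_) (fun z hz => ?_) fun z hz => ?_
  · exact Finset.mem_erase.2 ⟨(Finset.mem_filter.1 hz).2.ne, Finset.mem_univ _⟩
  · simp only [Finset.mem_sdiff, Finset.mem_erase, Finset.mem_univ, and_true, Finset.mem_filter,
      true_and] at hz
    rw [pointCount_eq_zero]
    · simp
    · rw [support_subset_iff hn]
      exact fun h => hz.2 (lt_of_le_of_ne h hz.1)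
  · rw [aeval_poincare_restrict_sub hn hinj e (Finset.mem_filter.1 hz).2.le]

open Classical in
theorem flatWeight_recursion (hadic : IsAdic (maximalIdeal 𝔬)) (hn : ∀ i, (L i).IsNonconstant K)
    (hinj : Function.Injective fun i => (L i).zeroLocus K)
    (e : (arrangement K L).IntPoset ≃o (arrangement (ResidueField 𝔬) L).IntPoset)
    {s : (arrangement K L).Nonbot → ℂ} (hs : s ∈ (arrangement K L).convDomain)
    (x : (arrangement K L).Nonbot) :
    flatWeight 𝔬 s x.1 = (residueCard 𝔬 : ℂ) ^ (-(arrangement K L).gFun s x) /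
        (1 - (residueCard 𝔬 : ℂ) ^ (-(arrangement K L).gFun s x)) *
      ∑ z : (arrangement K L).IntPoset with z < x.1,
        Polynomial.aeval (-(residueCard 𝔬 : ℂ)⁻¹)
          (((arrangement K L).restrict z).sub x.1.1).poincare * flatWeight 𝔬 s z := by
  have h1 := flatZeta_eq hadic hn hinj e hs x.1
  have h2 := flatWeight_eq (𝔬 := 𝔬) s x
  have h3 : 1 - (residueCard 𝔬 : ℂ) ^ (-(arrangement K L).gFun s x) ≠ 0 :=
    sub_ne_zero.2 (cpow_neg_ne_one (hs x)).symm
  rw [div_mul_eq_mul_div, eq_div_iff h3]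
  rw [eq_sub_of_add_eq' h1.symm]
  linear_combination (1 - 0) * h2

theorem analyticZeta_eq_sum (hadic : IsAdic (maximalIdeal 𝔬)) (hn : ∀ i, (L i).IsNonconstant K)
    (hinj : Function.Injective fun i => (L i).zeroLocus K)
    (e : (arrangement K L).IntPoset ≃o (arrangement (ResidueField 𝔬) L).IntPoset)
    {s : (arrangement K L).Nonbot → ℂ} (hs : s ∈ (arrangement K L).convDomain) :
    analyticZeta K L 𝔬 s = ∑ y : (arrangement K L).IntPoset,
      Polynomial.aeval (-(residueCard 𝔬 : ℂ)⁻¹) ((arrangement K L).restrict y).poincare *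
        flatWeight 𝔬 s y := by
  rw [analyticZeta, ← localIntegrand_univ, integral_localIntegrand_eq_sum hadic hn hinj e hs
    isClosedIndexSet_univ]
  exact Finset.sum_congr rfl fun y _ => by rw [aeval_poincare_restrict hn hinj e y]

theorem analyticZeta_eq_fHP (hadic : IsAdic (maximalIdeal 𝔬)) (hn : ∀ i, (L i).IsNonconstant K)
    (hinj : Function.Injective fun i => (L i).zeroLocus K)
    (e : (arrangement K L).IntPoset ≃o (arrangement (ResidueField 𝔬) L).IntPoset)
    {s : (arrangement K L).Nonbot → ℂ} (hs : s ∈ (arrangement K L).convDomain) :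
    analyticZeta K L 𝔬 s = (arrangement K L).fHP (-(residueCard 𝔬 : ℂ)⁻¹)
      fun x => (residueCard 𝔬 : ℂ) ^ (-(arrangement K L).gFun s x) := by
  classical
  rw [analyticZeta_eq_sum hadic hn hinj e hs, Arrangement.fHP_eq_flagSum,
    ← Arrangement.sum_mul_poincare_eq_flagSum _ _ _ _ (fun _ _ _ _ => trivial)
      (flatWeight 𝔬 s) (flatWeight_bot hn s) (flatWeight_recursion hadic hn hinj e hs)]
  refine Finset.sum_congr (Finset.ext fun y => ?_) fun _ _ => rfl
  simp

/-- For a central arrangement the top element contributes a geometric series. -/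
theorem analyticZeta_eq_of_isTop (hadic : IsAdic (maximalIdeal 𝔬))
    (hn : ∀ i, (L i).IsNonconstant K)
    (hinj : Function.Injective fun i => (L i).zeroLocus K)
    (e : (arrangement K L).IntPoset ≃o (arrangement (ResidueField 𝔬) L).IntPoset)
    {s : (arrangement K L).Nonbot → ℂ} (hs : s ∈ (arrangement K L).convDomain)
    (x : (arrangement K L).Nonbot) (hx : IsTop x.1) :
    analyticZeta K L 𝔬 s = 1 / (1 - (residueCard 𝔬 : ℂ) ^ (-(arrangement K L).gFun s x)) *
      (arrangement K L).flagSum (-(residueCard 𝔬 : ℂ)⁻¹)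
        (fun x => (residueCard 𝔬 : ℂ) ^ (-(arrangement K L).gFun s x) /
          (1 - (residueCard 𝔬 : ℂ) ^ (-(arrangement K L).gFun s x))) (fun y => ¬ IsTop y.1) ⊥ := by
  classical
  have hsupp : support L x.1.1 = Finset.univ := by
    refine Finset.eq_univ_of_forall fun i => (mem_support _ _).2 (hx (hyperplane hn i))
  have h1 : analyticZeta K L 𝔬 s = flatZeta 𝔬 s x.1 := by
    rw [analyticZeta, flatZeta, hsupp, localIntegrand_univ]
  have h2 := flatZeta_eq hadic hn hinj e hs x.1
  rw [flatWeight_eq s x] at h2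
  have h3 : 1 - (residueCard 𝔬 : ℂ) ^ (-(arrangement K L).gFun s x) ≠ 0 :=
    sub_ne_zero.2 (cpow_neg_ne_one (hs x)).symm
  have h4 : ∑ z : (arrangement K L).IntPoset with z < x.1,
      Polynomial.aeval (-(residueCard 𝔬 : ℂ)⁻¹)
        (((arrangement K L).restrict z).sub x.1.1).poincare * flatWeight 𝔬 s z =
      (arrangement K L).flagSum (-(residueCard 𝔬 : ℂ)⁻¹)
        (fun x => (residueCard 𝔬 : ℂ) ^ (-(arrangement K L).gFun s x) /
          (1 - (residueCard 𝔬 : ℂ) ^ (-(arrangement K L).gFun s x))) (fun y => ¬ IsTop y.1) ⊥ := by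
    rw [← Arrangement.sum_mul_poincare_eq_flagSum _ _ _ _
      (fun y z hyz hz hy => hz fun w => (hy w).trans hyz)
      (flatWeight 𝔬 s) (flatWeight_bot hn s) (flatWeight_recursion hadic hn hinj e hs)]
    refine Finset.sum_congr (Finset.ext fun y => ?_) fun y hy => ?_
    · simp only [Finset.mem_filter, Finset.mem_univ, true_and]
      constructor
      · exact fun h _ ht => (ht x.1).not_gt h
      · intro h
        refine lt_of_le_of_ne (hx y) ?_
        rintro rfl
        exact h x.2 hx
    · rw [aeval_poincare_restrict_sub hn hinj e (hx y), hsupp, aeval_poincare_restrict hn hinj e]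
  rw [h1, ← h4, one_div, inv_mul_eq_div, eq_div_iff h3]
  linear_combination h2

end FlagFormula

end AffineForm

namespace Arrangement

section Continuation

variable {k V : Type*} [Field k] [AddCommGroup V] [Module k V]

theorem analyticAt_gFun (A : Arrangement k V) (x : A.Nonbot) (s : A.Nonbot → ℂ) :
    AnalyticAt ℂ (fun s => A.gFun s x) s := by
  classical
  unfold gFun
  refine analyticAt_const.add (Finset.analyticAt_fun_sum _ fun y _ => ?_)
  exact (ContinuousLinearMap.proj (R := ℂ) (φ := fun _ : A.Nonbot => ℂ) y).analyticAt s

theorem continuous_gFun (A : Arrangement k V) (x : A.Nonbot) :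
    Continuous fun s => A.gFun s x :=
  continuous_iff_continuousAt.2 fun s => (A.analyticAt_gFun x s).continuousAt

theorem continuous_hFun (A : Arrangement k V) : Continuous A.hFun := by
  classical
  unfold hFun
  fun_prop

theorem analyticAt_cpow_gFun (A : Arrangement k V) {q : ℂ} (hq : q ≠ 0) (x : A.Nonbot)
    (s : A.Nonbot → ℂ) : AnalyticAt ℂ (fun s => q ^ (-A.gFun s x)) s := by
  simp_rw [Complex.cpow_def_of_ne_zero hq]
  exact (analyticAt_const.mul (A.analyticAt_gFun x s).neg).cexp

theorem isOpen_convDomain (A : Arrangement k V) : IsOpen A.convDomain := by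
  unfold convDomain
  simp only [Set.ofPred_forall]
  refine isOpen_iInter_of_finite fun x => ?_
  exact isOpen_lt continuous_const (Complex.continuous_re.comp (A.continuous_gFun x))

theorem isOpen_regularDomain (A : Arrangement k V) {q : ℂ} (hq : q ≠ 0) :
    IsOpen (A.regularDomain q) := by
  unfold regularDomain
  simp only [Set.ofPred_forall]
  refine isOpen_iInter_of_finite fun x => ?_
  refine isOpen_ne_fun ?_ continuous_const
  exact continuous_iff_continuousAt.2 fun s => (A.analyticAt_cpow_gFun hq x s).continuousAt

theorem convDomain_nonempty (A : Arrangement k V) : A.convDomain.Nonempty :=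
  ⟨A.hFun fun _ => 1, fun x => by rw [gFun_hFun]; simp⟩

theorem isConnected_cpow_ne_one {q : ℂ} (hq : Complex.log q ≠ 0) (hq0 : q ≠ 0) :
    IsConnected {z : ℂ | q ^ (-z) ≠ 1} := by
  have hc : {z : ℂ | q ^ (-z) = 1}.Countable := by
    refine (Set.countable_range fun n : ℤ =>
      -(n * (2 * Real.pi * Complex.I)) / Complex.log q).mono fun z hz => ?_
    have hz' : q ^ (-z) = 1 := hz
    rw [Complex.cpow_def_of_ne_zero hq0, Complex.exp_eq_one_iff] at hz'
    obtain ⟨n, hn⟩ := hz'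
    refine ⟨n, ?_⟩
    simp only [← hn]
    field_simp
  have := (hc.isPathConnected_compl_of_one_lt_rank (E := ℂ) (by
    rw [Complex.rank_real_complex]; norm_num)).isConnected
  exact this

theorem isConnected_regularDomain (A : Arrangement k V) {q : ℂ} (hq : Complex.log q ≠ 0)
    (hq0 : q ≠ 0) : IsConnected (A.regularDomain q) := by
  have h : A.regularDomain q =
      A.hFun '' Set.univ.pi fun _ : A.Nonbot => {z : ℂ | q ^ (-z) ≠ 1} := by
    ext s
    constructor
    · exact fun hs => ⟨A.gFun s, fun x _ => hs x, A.hFun_gFun s⟩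
    · rintro ⟨r, hr, rfl⟩ x
      rw [gFun_hFun]
      exact hr x trivial
  rw [h]
  exact (isConnected_univ_pi.2 fun _ => isConnected_cpow_ne_one hq hq0).image _
    A.continuous_hFun.continuousOn

theorem analyticAt_listProd {E α : Type*} [NormedAddCommGroup E] [NormedSpace ℂ E] (l : List α)
    {f : α → E → ℂ} {s : E} (h : ∀ x, AnalyticAt ℂ (f x) s) :
    AnalyticAt ℂ (fun s => (l.map fun x => f x s).prod) s := by
  induction l with
  | nil => simpa using analyticAt_const
  | cons x l ih =>
    simp only [List.map_cons, List.prod_cons]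
    exact (h x).mul ih

theorem analyticOnNhd_fHP [FiniteDimensional k V] (A : Arrangement k V) {q : ℂ} (hq : q ≠ 0)
    (Y : ℂ) : AnalyticOnNhd ℂ (fun s => A.fHP Y fun x => q ^ (-A.gFun s x))
      (A.regularDomain q) := by
  intro s hs
  unfold fHP
  refine Finset.analyticAt_fun_sum _ fun F _ => analyticAt_const.mul ?_
  refine analyticAt_listProd F.1 fun x => ?_
  exact (A.analyticAt_cpow_gFun hq x s).div
    (analyticAt_const.sub (A.analyticAt_cpow_gFun hq x s)) (sub_ne_zero.2 (hs x).symm)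

theorem IsCentral.exists_isTop {A : Arrangement k V} (hA : A.IsCentral) :
    ∃ x : A.IntPoset, IsTop x := by
  refine ⟨⟨_, hA, A.members, subset_rfl, rfl⟩, ?_⟩
  rintro ⟨y, hy, S, hS, rfl⟩
  exact inf_le_inf_left A.ambient (Finset.inf_mono (f := id) hS)

theorem rank_eq_codim_of_isTop [FiniteDimensional k V] {A : Arrangement k V} {x : A.IntPoset}
    (hx : IsTop x) : A.rank = A.codim x := by
  rw [rank]
  refine le_antisymm (Finset.sup_le fun y _ => ?_) ?_
  · rw [rk_eq_codim]
    exact A.codim_strictMono.monotone (hx y)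
  · rw [← rk_eq_codim]
    exact Finset.le_sup (Finset.mem_univ x)

end Continuation

end Arrangement

end

theorem theoremB {K : Type*} [Field K] [NumberField K] {d : ℕ} {ι : Type*} [Fintype ι]
    (L : ι → AffineForm (NumberField.RingOfIntegers K) d)
    (hL : ∀ i, (L i).IsNonconstant K)
    (hinj : Function.Injective fun i => (L i).zeroLocus K)
    {𝔬 : Type*} [CommRing 𝔬] [IsDomain 𝔬] [IsDiscreteValuationRing 𝔬]
    [TopologicalSpace 𝔬] [IsTopologicalRing 𝔬] [CompactSpace 𝔬]
    [MeasurableSpace 𝔬] [BorelSpace 𝔬] (hadic : IsAdic (IsLocalRing.maximalIdeal 𝔬))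
    [Algebra (NumberField.RingOfIntegers K) 𝔬]
    (hgood : HasGoodReduction K L 𝔬)
    (q : ℂ) (hq : q = residueCard 𝔬) :
    -- the zeta function as a value of the flag Hilbert–Poincaré series
    (∀ s ∈ (AffineForm.arrangement K L).convDomain,
      Integrable (zetaIntegrand K L s) (cubeHaar 𝔬 d) ∧
      analyticZeta K L 𝔬 s = (AffineForm.arrangement K L).fHP (-q⁻¹)
        (fun x => q ^ (-(AffineForm.arrangement K L).gFun s x))) ∧
    -- the flag Hilbert–Poincaré series as a value of the zeta function
    (∀ r : (AffineForm.arrangement K L).Nonbot → ℂ, (∀ x, 0 < (r x).re) →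
      Integrable (zetaIntegrand K L ((AffineForm.arrangement K L).hFun r)) (cubeHaar 𝔬 d) ∧
      (AffineForm.arrangement K L).fHP (-q⁻¹) (fun x => q ^ (-r x)) =
        analyticZeta K L 𝔬 ((AffineForm.arrangement K L).hFun r)) ∧
    -- both identities for the analytic continuation
    (∃ Z : ((AffineForm.arrangement K L).Nonbot → ℂ) → ℂ,
      IsAnalyticContinuation (analyticZeta K L 𝔬) (AffineForm.arrangement K L).convDomain
        Z ((AffineForm.arrangement K L).regularDomain q) ∧
      (∀ s ∈ (AffineForm.arrangement K L).regularDomain q,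
        Z s = (AffineForm.arrangement K L).fHP (-q⁻¹)
          (fun x => q ^ (-(AffineForm.arrangement K L).gFun s x))) ∧
      (∀ r : (AffineForm.arrangement K L).Nonbot → ℂ, (∀ x, q ^ (-r x) ≠ 1) →
        (AffineForm.arrangement K L).hFun r ∈ (AffineForm.arrangement K L).regularDomain q ∧
        (AffineForm.arrangement K L).fHP (-q⁻¹) (fun x => q ^ (-r x)) =
          Z ((AffineForm.arrangement K L).hFun r))) ∧
    -- the explicit sum over flags
    (∀ s ∈ (AffineForm.arrangement K L).convDomain, analyticZeta K L 𝔬 s =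
      ∑ F : (AffineForm.arrangement K L).Flag,
        Polynomial.aeval (-q⁻¹) ((AffineForm.arrangement K L).flagPoincare F) *
        (F.1.map fun x => q ^ (-(AffineForm.arrangement K L).gFun s x) /
          (1 - q ^ (-(AffineForm.arrangement K L).gFun s x))).prod) ∧
    -- the explicit sum over flags avoiding the top element, for central arrangements
    ((AffineForm.arrangement K L).IsCentral → Nonempty ι →
      ∀ s ∈ (AffineForm.arrangement K L).convDomain, analyticZeta K L 𝔬 s =
        1 / (1 - q ^ (-((AffineForm.arrangement K L).rank : ℂ) - ∑ y, s y)) *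
        open Classical in
        ∑ F : (AffineForm.arrangement K L).Flag with ∀ x ∈ F.1, ¬ IsTop x.1,
          Polynomial.aeval (-q⁻¹) ((AffineForm.arrangement K L).flagPoincare F) *
          (F.1.map fun x => q ^ (-(AffineForm.arrangement K L).gFun s x) /
            (1 - q ^ (-(AffineForm.arrangement K L).gFun s x))).prod) := by
  classical
  subst hq
  have := hadic.secondCountableTopology
  have := hadic.t2Space
  have := hadic.finite_residueField
  have := Fintype.ofFinite (ResidueField 𝔬)
  obtain ⟨e⟩ := hgood
  have hq1 := one_lt_residueCard 𝔬
  have hq0 : (residueCard 𝔬 : ℂ) ≠ 0 := by exact_mod_cast (zero_lt_one.trans hq1).ne'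
  have hlog : Complex.log (residueCard 𝔬) ≠ 0 := by
    rw [Complex.natCast_log.symm]
    exact_mod_cast (Real.log_pos (by exact_mod_cast hq1)).ne'
  set A := AffineForm.arrangement K L with hA
  have h1 : ∀ s ∈ A.convDomain, Integrable (zetaIntegrand K L s) (cubeHaar 𝔬 d) ∧
      analyticZeta K L 𝔬 s = A.fHP (-(residueCard 𝔬 : ℂ)⁻¹)
        (fun x => (residueCard 𝔬 : ℂ) ^ (-A.gFun s x)) := by
    refine fun s hs => ⟨?_, AffineForm.analyticZeta_eq_fHP hadic hL hinj e hs⟩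
    rw [← AffineForm.localIntegrand_univ]
    exact AffineForm.integrable_localIntegrand hadic hL hinj e hs AffineForm.isClosedIndexSet_univ
  refine ⟨h1, fun r hr => ?_, ⟨fun s => A.fHP (-(residueCard 𝔬 : ℂ)⁻¹)
    (fun x => (residueCard 𝔬 : ℂ) ^ (-A.gFun s x)), ?_, fun s _ => rfl, fun r hr => ?_⟩,
    fun s hs => (h1 s hs).2, fun hcentral hne s hs => ?_⟩
  · have h2 := h1 (A.hFun r) fun x => by rw [A.gFun_hFun]; exact hr x
    rw [A.gFun_hFun] at h2
    exact ⟨h2.1, h2.2.symm⟩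
  · exact {
      isOpen_left := A.isOpen_convDomain
      nonempty := A.convDomain_nonempty
      isOpen := A.isOpen_regularDomain hq0
      isConnected := A.isConnected_regularDomain hlog hq0
      subset := fun s hs x => AffineForm.cpow_neg_ne_one (hs x)
      analytic := A.analyticOnNhd_fHP hq0 _
      eqOn := fun s hs => (h1 s hs).2.symm }
  · refine ⟨fun x => by rw [A.gFun_hFun]; exact hr x, ?_⟩
    change A.fHP _ _ = A.fHP _ fun x => (residueCard 𝔬 : ℂ) ^ (-A.gFun (A.hFun r) x)
    rw [A.gFun_hFun]
  · obtain ⟨x, hx⟩ := hcentral.exists_isTop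
    obtain ⟨i⟩ := hne
    have hbot : x ≠ ⊥ := by
      intro h0
      have h2 := ((A.isAtom_iff_mem_members (AffineForm.hyperplane hL i)).2
        (AffineForm.zeroLocus_mem_members hL i)).1
      exact h2 (le_bot_iff.1 (h0 ▸ hx _))
    have hg : A.gFun s ⟨x, hbot⟩ = A.rank + ∑ y, s y := by
      rw [A.gFun_eq, Arrangement.rank_eq_codim_of_isTop hx, Finset.filter_true_of_mem]
      exact fun y _ => hx y.1
    rw [AffineForm.analyticZeta_eq_of_isTop hadic hL hinj e hs ⟨x, hbot⟩ hx, hg, neg_add',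
      Arrangement.flagSum_bot]
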